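/- Let $K\ge 2$ be an integer and $\alpha>0$. Let $F_K$ be the rational function with $F_K(\cot\theta)=\cot K\theta$, and let $S_{K,\alpha}(x)=\alpha K F_K(x)$, a map of the real line defined off the null set of points whose orbit meets a pole. Say that Condition A holds if $0<\alpha<1$ ($K$ even), respectively $1/K^2<\alpha<1$ ($K$ odd). If Condition A holds, there is exactly one $\gamma=\gamma_{K,\alpha}>0$ for which the Cauchy density $\frac1\pi\frac{\gamma}{x^2+\gamma^2}$ is invariant under $S_{K,\alpha}$, the function $\log|S_{K,\alpha}'|$ is integrable against it, and the Lyapunov exponent is $$\lambda_{K,\alpha}=\frac1\pi\int_{-\infty}^{\infty}\log|S_{K,\alpha}'(x)|\,\frac{\gamma_{K,\alpha}}{x^2+\gamma_{K,\alpha}^2}\,dx .$$ If $\alpha>1$, then for Lebesgue almost every $x$ the orbit satisfies $|S_{K,\alpha}^n(x)|\to\infty$, and the Lyapunov exponent $\lambda_{K,\alpha}$, defined as the almost everywhere limit $\lim_{n\to\infty}\frac1n\sum_{i<n}\log|S_{K,\alpha}'(S_{K,\alpha}^i(x))|$, exists and equals $\log\alpha$. Say that $\lambda_{K,\alpha}$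 has critical exponent $\nu$ at $\alpha_c$, from one side, if there is a constant $b>0$ (depending on $K$) with $\lambda_{K,\alpha}\sim b\,|\alpha-\alpha_c|^{\nu}$, i.e. the ratio of the two sides tends to $1$, as $\alpha\to\alpha_c$ from that side. **Theorem.** For every integer $K\ge2$ the following hold. * At $\alpha_c=1$, as $\alpha\to1^-$, the critical exponent is $\nu_1=\frac12$. * At $\alpha_c=1$, as $\alpha\to1^+$, the critical exponent is $\nu_1=1$. * If $K$ is odd, then at $\alpha_c=1/K^2$, as $\alpha\to (1/K^2)^+$, the critical exponent is $\nu_2=\frac12$. Moreover, the two critical points are points of Type 1 intermittency (Floquet multiplier $1$): $S_{K,1}(x)\to\infty$ and $S_{K,1}'(x)\to1$ as $|x|\to\infty$, and, for odd $K$, $S_{K,1/K^2}(0)=0$ and $S_{K,1/K^2}'(0)=1$. Hence $\lambda_{K,\alpha}\sim b\,|\alpha-\alpha_c|^{1/2}$ when such a point is approached from within Condition A. The existence and uniqueness of $\gamma_{K,\alpha}$, the integrability, and the assertions on $\alpha>1$ above are part of the theorem. -/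

import Mathlib

open Filter Topology MeasureTheory ProbabilityTheory
open scoped NNReal

namespace SGB

/-- The `K`-angle formula of the cotangent, `F_K (cot θ) = cot (K θ)` (see `cotAngle_cot`), as a
real rational function: `(cos θ + i sin θ) ^ K / sin θ ^ K = (x + i) ^ K` for `x = cot θ`.
At the (finitely many) poles it takes the value `0`. -/
noncomputable def cotAngle (K : ℕ) (x : ℝ) : ℝ :=
  (((x : ℂ) + Complex.I) ^ K).re / (((x : ℂ) + Complex.I) ^ K).im

theorem cotAngle_cot (K : ℕ) (θ : ℝ) (hθ : Real.sin θ ≠ 0) :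
    cotAngle K (Real.cot θ) = Real.cot (K * θ) := by
  have hs : ((Real.sin θ : ℝ) : ℂ) ≠ 0 := by exact_mod_cast hθ
  have h1 : ((Real.cot θ : ℝ) : ℂ) + Complex.I
      = ((Real.sin θ : ℝ) : ℂ)⁻¹ * (Complex.cos θ + Complex.sin θ * Complex.I) := by
    rw [Real.cot_eq_cos_div_sin]
    push_cast at hs ⊢
    field_simp
  have h2 : (((Real.cot θ : ℝ) : ℂ) + Complex.I) ^ K
      = (((Real.sin θ)⁻¹ ^ K : ℝ) : ℂ)
        * (((Real.cos (K * θ) : ℝ) : ℂ) + ((Real.sin (K * θ) : ℝ) : ℂ) * Complex.I) := by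
    rw [h1, mul_pow, Complex.cos_add_sin_mul_I_pow]
    push_cast
    ring
  have h3 : (Real.sin θ)⁻¹ ^ K ≠ 0 := pow_ne_zero _ (inv_ne_zero hθ)
  unfold cotAngle
  rw [h2, Complex.re_ofReal_mul, Complex.im_ofReal_mul, Real.cot_eq_cos_div_sin,
    mul_div_mul_left _ _ h3]
  rw [← Complex.mk_eq_add_mul_I]

/-- The super generalized Boole transformation `S_{K,α} = α K F_K`. It is regarded as a map of the
whole line; the points whose orbit meets a pole form a Lebesgue null (countable) set. -/
noncomputable def sgb (K : ℕ) (α x : ℝ) : ℝ := α * K * cotAngle K x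

/-- Condition A on the parameters: `0 < α < 1` for even `K`, and `1 / K ^ 2 < α < 1` for
odd `K`. -/
def ConditionA (K : ℕ) (α : ℝ) : Prop :=
  (Even K ∧ 0 < α ∧ α < 1) ∨ (Odd K ∧ 1 / (K : ℝ) ^ 2 < α ∧ α < 1)

/-- `γ > 0` is the scale of a centred Cauchy law with density `γ / (π (x ^ 2 + γ ^ 2))` that is
invariant under `S_{K,α}`. -/
def IsInvariantScale (K : ℕ) (α : ℝ) (γ : ℝ≥0) : Prop :=
  0 < γ ∧ MeasurePreserving (sgb K α) (cauchyMeasure 0 γ) (cauchyMeasure 0 γ)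

open Classical in
/-- The scale `γ_{K,α}` of the invariant Cauchy law (the value `0` stands for its absence). -/
noncomputable def invariantScale (K : ℕ) (α : ℝ) : ℝ≥0 :=
  if h : ∃ γ, IsInvariantScale K α γ then h.choose else 0

/-- The integrand `log |S_{K,α}'(x)|`. -/
noncomputable def logAbsDeriv (K : ℕ) (α x : ℝ) : ℝ := Real.log |deriv (sgb K α) x|

/-- The mean exponential rate of expansion along the first `n` points of the orbit of `x`. -/
noncomputable def orbitMean (K : ℕ) (α x : ℝ) (n : ℕ) : ℝ :=
  (n : ℝ)⁻¹ * ∑ i ∈ Finset.range n, logAbsDeriv K α ((sgb K α)^[i] x)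

/-- `L` is the Lyapunov exponent of Lebesgue almost every orbit of `S_{K,α}`. -/
def IsOrbitExponent (K : ℕ) (α L : ℝ) : Prop :=
  ∀ᵐ x : ℝ, Tendsto (orbitMean K α x) atTop (𝓝 L)

open Classical in
/-- The Lyapunov exponent `λ_{K,α}`. For `α > 1`, where there is no invariant Cauchy law, it is the
exponent of almost every orbit; otherwise it is the integral of `log |S_{K,α}'|` against the
invariant Cauchy law. -/
noncomputable def lyapunov (K : ℕ) (α : ℝ) : ℝ :=
  if 1 < α then Classical.epsilon (IsOrbitExponent K α)
  else ∫ x, logAbsDeriv K α x ∂(cauchyMeasure 0 (invariantScale K α))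

/-- The function `lam` has critical exponent `ν` at `αc` along the (one-sided) filter `l`:
`lam α ∼ b |α - αc| ^ ν` for some constant `b > 0`. -/
def HasCriticalExponent (lam : ℝ → ℝ) (l : Filter ℝ) (αc ν : ℝ) : Prop :=
  ∃ b : ℝ, 0 < b ∧ Asymptotics.IsEquivalent l lam (fun α => b * |α - αc| ^ ν)

/-- The map `f` has a fixed point at `p` whose Floquet multiplier is `1` (Type 1). -/
def IsTangentAt (f : ℝ → ℝ) (p : ℝ) : Prop := f p = p ∧ HasDerivAt f 1 p

/-- The map `f` has a fixed point at infinity whose Floquet multiplier is `1` (Type 1). -/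
def IsTangentAtInfinity (f : ℝ → ℝ) : Prop :=
  Tendsto f (cocompact ℝ) (cocompact ℝ) ∧ Tendsto (deriv f) (cocompact ℝ) (𝓝 1)

end SGB

/-! The Cayley transform turns `cotAngle K` into `z ↦ z ^ K` on the unit circle. The centred Cauchy
law of scale `γ` becomes the harmonic measure of the disc seen from `w = (γ - 1) / (γ + 1)`, whose
moments are `w ^ n`; hence `cotAngle K` sends the law at `w` to the law at `w ^ K`
(`measurePreserving_cotAngle`). Multiplication by `α K` rescales `γ`, so invariance is the single
equation `scaleRatio K w = α * K`. Under Condition A it has one root in `(-1, 1)`, by strict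
monotonicity and the intermediate value theorem.

Since `F_K' = K (1 + F_K ^ 2) / (1 + x ^ 2)`, the exponent needs only the integral of `log (1 + x ^
2)`, which Jensen's formula gives as `2 log (1 + γ)`. The result is `-log ((∑ w ^ (2j)) / K)`. As `w
→ 1` this vanishes to first order in `1 - w`, whereas `K - scaleRatio K w` vanishes to second order:
this is the exponent `1/2`. For odd `K`, `w ↦ -w` inverts `scaleRatio` and fixes the exponent, so `1
/ K ^ 2` reduces to the same limit.

For `α > 1`, `scaleRatio ≤ K` makes the scale grow by a factor at least `α` at each step.
Borel–Cantelli sends almost every orbit to infinity, where the derivative tends to `α`. -/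

namespace SGB

/-! ### Integrals against a Cauchy law as circle averages -/

section CauchyLaw

variable {E : Type*} [NormedAddCommGroup E] [NormedSpace ℝ E]

/-- The parametrization of the line by the angle `θ ∈ (0, 2π)` that carries the uniform law to the
centred Cauchy law of scale `γ`. -/
noncomputable def cauchyParam (γ θ : ℝ) : ℝ := γ * Real.tan ((θ - Real.pi) / 2)

theorem cos_half_sub_pi_pos {θ : ℝ} (hθ : θ ∈ Set.Ioo 0 (2 * Real.pi)) :
    0 < Real.cos ((θ - Real.pi) / 2) :=
  Real.cos_pos_of_mem_Ioo ⟨by linarith [hθ.1], by linarith [hθ.2]⟩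

theorem hasDerivAt_cauchyParam (γ : ℝ) {θ : ℝ} (hθ : θ ∈ Set.Ioo 0 (2 * Real.pi)) :
    HasDerivAt (cauchyParam γ) (γ * (1 / Real.cos ((θ - Real.pi) / 2) ^ 2 * (1 / 2))) θ := by
  have h1 : HasDerivAt (fun θ : ℝ => (θ - Real.pi) / 2) (1 / 2) θ :=
    ((hasDerivAt_id θ).sub_const _).div_const 2
  exact ((Real.hasDerivAt_tan (cos_half_sub_pi_pos hθ).ne').comp θ h1).const_mul γ

theorem injOn_cauchyParam {γ : ℝ} (hγ : 0 < γ) :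
    Set.InjOn (cauchyParam γ) (Set.Ioo 0 (2 * Real.pi)) := by
  intro a ha b hb hab
  have h := mul_left_cancel₀ hγ.ne' hab
  have := Real.tan_inj_of_lt_of_lt_pi_div_two (by linarith [ha.1]) (by linarith [ha.2])
    (by linarith [hb.1]) (by linarith [hb.2]) h
  linarith

theorem image_cauchyParam {γ : ℝ} (hγ : 0 < γ) :
    cauchyParam γ '' Set.Ioo 0 (2 * Real.pi) = Set.univ := by
  refine Set.eq_univ_of_forall fun x => ⟨2 * Real.arctan (x / γ) + Real.pi, ⟨?_, ?_⟩, ?_⟩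
  · linarith [Real.neg_pi_div_two_lt_arctan (x / γ)]
  · linarith [Real.arctan_lt_pi_div_two (x / γ)]
  · rw [cauchyParam, add_sub_cancel_right, mul_div_cancel_left₀ _ two_ne_zero, Real.tan_arctan]
    field_simp

/-- The Jacobian of `cauchyParam` cancels the Cauchy density up to the constant `1 / (2π)`. -/
theorem abs_deriv_smul_cauchyPDFReal {γ : ℝ≥0} (hγ : 0 < γ) {θ : ℝ}
    (hθ : θ ∈ Set.Ioo 0 (2 * Real.pi)) (f : ℝ → E) :
    |(γ : ℝ) * (1 / Real.cos ((θ - Real.pi) / 2) ^ 2 * (1 / 2))| •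
        (cauchyPDFReal 0 γ (cauchyParam γ θ) • f (cauchyParam γ θ))
      = (2 * Real.pi)⁻¹ • f (cauchyParam γ θ) := by
  have hg : (0 : ℝ) < γ := hγ
  have hc := cos_half_sub_pi_pos hθ
  rw [smul_smul]
  congr 1
  rw [abs_of_nonneg (by positivity), cauchyPDFReal, cauchyParam, Real.tan_eq_sin_div_cos]
  have hs : Real.sin ((θ - Real.pi) / 2) ^ 2 = 1 - Real.cos ((θ - Real.pi) / 2) ^ 2 :=
    Real.sin_sq _
  have h2 : ((γ : ℝ) * (Real.sin ((θ - Real.pi) / 2) / Real.cos ((θ - Real.pi) / 2)) - 0) ^ 2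
      + (γ : ℝ) ^ 2 = (γ : ℝ) ^ 2 / Real.cos ((θ - Real.pi) / 2) ^ 2 := by
    rw [sub_zero, mul_pow, div_pow, hs]
    field_simp
    ring
  rw [h2]
  field_simp

theorem integral_cauchyMeasure {γ : ℝ≥0} (hγ : 0 < γ) (f : ℝ → E) :
    ∫ x, f x ∂(cauchyMeasure 0 γ)
      = (2 * Real.pi)⁻¹ • ∫ θ in (0)..(2 * Real.pi), f (cauchyParam γ θ) := by
  rw [cauchyMeasure_of_scale_ne_zero _ hγ.ne',
    integral_withDensity_eq_integral_toReal_smul (measurable_cauchyPDF _ _)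
      (ae_of_all _ fun x => ENNReal.ofReal_lt_top)]
  simp only [cauchyPDF, ENNReal.toReal_ofReal (cauchyPDF_pos 0 hγ.ne' _).le]
  rw [← setIntegral_univ, ← image_cauchyParam (show (0 : ℝ) < γ from hγ),
    integral_image_eq_integral_abs_deriv_smul measurableSet_Ioo
      (fun θ hθ => (hasDerivAt_cauchyParam γ hθ).hasDerivWithinAt) (injOn_cauchyParam hγ),
    setIntegral_congr_fun measurableSet_Ioo
      (fun θ hθ => abs_deriv_smul_cauchyPDFReal hγ hθ f), integral_smul,
    intervalIntegral.integral_of_le Real.two_pi_pos.le, integral_Ioc_eq_integral_Ioo]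

theorem integrable_cauchyMeasure_iff {γ : ℝ≥0} (hγ : 0 < γ) (f : ℝ → E) :
    Integrable f (cauchyMeasure 0 γ)
      ↔ IntegrableOn (fun θ => f (cauchyParam γ θ)) (Set.Ioo 0 (2 * Real.pi)) := by
  rw [cauchyMeasure_of_scale_ne_zero _ hγ.ne',
    integrable_withDensity_iff_integrable_smul' (measurable_cauchyPDF _ _)
      (ae_of_all _ fun x => ENNReal.ofReal_lt_top)]
  simp only [cauchyPDF, ENNReal.toReal_ofReal (cauchyPDF_pos 0 hγ.ne' _).le]
  rw [← integrableOn_univ, ← image_cauchyParam (show (0 : ℝ) < γ from hγ),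
    integrableOn_image_iff_integrableOn_abs_deriv_smul measurableSet_Ioo
      (fun θ hθ => (hasDerivAt_cauchyParam γ hθ).hasDerivWithinAt) (injOn_cauchyParam hγ),
    integrableOn_congr_fun (fun θ hθ => abs_deriv_smul_cauchyPDFReal hγ hθ f) measurableSet_Ioo]
  exact integrable_smul_iff (inv_ne_zero Real.two_pi_pos.ne') _

/-- On the boundary, `cauchyParam` is the Möbius map `ζ ↦ iγ (1 + ζ) / (1 - ζ)` from the disc to the
upper half-plane, which sends `0` to `iγ`. The relation is kept free of denominators. -/
theorem cauchyParam_mul_one_sub_circleMap (γ : ℝ) {θ : ℝ} (hθ : θ ∈ Set.Ioo 0 (2 * Real.pi)) :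
    (cauchyParam γ θ : ℂ) * (1 - circleMap 0 1 θ)
      = Complex.I * γ * (1 + circleMap 0 1 θ) := by
  have hc : (Complex.cos (((θ - Real.pi) / 2 : ℝ) : ℂ)) ≠ 0 := by
    rw [← Complex.ofReal_cos]
    exact_mod_cast (cos_half_sub_pi_pos hθ).ne'
  have hζ : circleMap 0 1 θ = -(Complex.cos (((θ - Real.pi) / 2 : ℝ) : ℂ)
      + Complex.sin (((θ - Real.pi) / 2 : ℝ) : ℂ) * Complex.I) ^ 2 := by
    rw [← Complex.exp_mul_I, ← Complex.exp_nat_mul, circleMap_zero]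
    have : ((2 : ℕ) : ℂ) * ((((θ - Real.pi) / 2 : ℝ) : ℂ) * Complex.I)
        = θ * Complex.I - Real.pi * Complex.I := by push_cast; ring
    rw [this, Complex.exp_sub_pi_mul_I]
    simp
  rw [hζ, cauchyParam, Real.tan_eq_sin_div_cos]
  push_cast at hc ⊢
  set c := Complex.cos (((θ : ℂ) - Real.pi) / 2)
  set s := Complex.sin (((θ : ℂ) - Real.pi) / 2)
  have hcs : s ^ 2 + c ^ 2 = 1 := Complex.sin_sq_add_cos_sq _
  have hI : Complex.I ^ 2 = -1 := Complex.I_sq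
  field_simp
  linear_combination γ * (Complex.I * c - s) * hcs
    + γ * (s ^ 3 + 2 * c ^ 2 * s + s ^ 2 * c * Complex.I) * hI

theorem integral_cauchyMeasure_eq_circleAverage {γ : ℝ≥0} (hγ : 0 < γ) {f : ℝ → E} {g : ℂ → E}
    (h : ∀ (x : ℝ) (ζ : ℂ), ‖ζ‖ = 1 → x * (1 - ζ) = Complex.I * γ * (1 + ζ) → f x = g ζ) :
    ∫ x, f x ∂(cauchyMeasure 0 γ) = Real.circleAverage g 0 1 := by
  rw [integral_cauchyMeasure hγ, Real.circleAverage_def,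
    intervalIntegral.integral_of_le Real.two_pi_pos.le,
    intervalIntegral.integral_of_le Real.two_pi_pos.le,
    integral_Ioc_eq_integral_Ioo, integral_Ioc_eq_integral_Ioo]
  congr 1
  refine setIntegral_congr_fun measurableSet_Ioo fun θ hθ => ?_
  exact h _ _ (by simp) (cauchyParam_mul_one_sub_circleMap γ hθ)

theorem integrable_cauchyMeasure_of_circleIntegrable {γ : ℝ≥0} (hγ : 0 < γ) {f : ℝ → E}
    {g : ℂ → E}
    (h : ∀ (x : ℝ) (ζ : ℂ), ‖ζ‖ = 1 → x * (1 - ζ) = Complex.I * γ * (1 + ζ) → f x = g ζ)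
    (hg : CircleIntegrable g 0 1) : Integrable f (cauchyMeasure 0 γ) := by
  rw [integrable_cauchyMeasure_iff hγ]
  have hg' := (intervalIntegrable_iff_integrableOn_Ioo_of_le Real.two_pi_pos.le).1 hg
  refine hg'.congr_fun (fun θ hθ => ?_) measurableSet_Ioo
  exact (h _ _ (by simp) (cauchyParam_mul_one_sub_circleMap γ hθ)).symm

end CauchyLaw

/-! ### The integral of `log (1 + x ^ 2)` -/

theorem norm_ofReal_mul_add_one {w : ℝ} {ζ : ℂ} (hζ : ‖ζ‖ = 1) :
    ‖(w : ℂ) * ζ + 1‖ = ‖ζ + w‖ := by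
  have h1 : ζ * (starRingEnd ℂ) ζ = 1 := by
    rw [Complex.mul_conj, Complex.normSq_eq_norm_sq, hζ]; simp
  have h2 : (w : ℂ) * ζ + 1 = ζ * (starRingEnd ℂ) (ζ + w) := by
    rw [map_add, mul_add, h1, Complex.conj_ofReal]; ring
  rw [h2, norm_mul, hζ, one_mul, Complex.norm_conj]

/-- The coordinate of `iγ` in the unit disc. -/
noncomputable def discCoord (γ : ℝ) : ℝ := (γ - 1) / (γ + 1)

theorem abs_discCoord_lt_one {γ : ℝ} (hγ : 0 < γ) : |discCoord γ| < 1 := by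
  rw [discCoord, abs_lt]
  constructor
  · rw [lt_div_iff₀ (by linarith)]; linarith
  · rw [div_lt_one (by linarith)]; linarith

/-- Here `1 + x ^ 2 = ‖x + i‖ ^ 2` and `x + i = i (γ + 1) (1 + w ζ) / (1 - ζ)` with `w = discCoord
γ`; on the circle `‖1 + w ζ‖ = ‖ζ + w‖`. -/
theorem log_one_add_sq_eq {γ x : ℝ} (hγ : 0 < γ) {ζ : ℂ} (hζ : ‖ζ‖ = 1)
    (h : x * (1 - ζ) = Complex.I * γ * (1 + ζ)) :
    Real.log (1 + x ^ 2) = 2 * (Real.log (1 + γ) + Real.log ‖ζ + (discCoord γ : ℂ)‖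
      - Real.log ‖ζ - 1‖) := by
  have hg1 : ((γ : ℂ) + 1) ≠ 0 := by
    have : (γ + 1 : ℝ) ≠ 0 := by linarith
    exact_mod_cast this
  have hγ' : (γ : ℂ) ≠ 0 := by exact_mod_cast hγ.ne'
  have hne : ζ - 1 ≠ 0 := by
    intro h0
    have hz : ζ = 1 := by linear_combination h0
    rw [hz] at h
    have : Complex.I * (γ : ℂ) = 0 := by linear_combination -h / 2
    simp [hγ'] at this
  have key : ((x : ℂ) + Complex.I) * (1 - ζ)
      = Complex.I * (((γ : ℂ) + 1) * ((discCoord γ : ℝ) * ζ + 1)) := by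
    rw [discCoord]; push_cast
    field_simp
    linear_combination h
  have hn := congrArg norm key
  have hgn : ‖(γ : ℂ) + 1‖ = 1 + γ := by
    have : (γ : ℂ) + 1 = ((1 + γ : ℝ) : ℂ) := by push_cast; ring
    rw [this, Complex.norm_real, Real.norm_of_nonneg (by linarith)]
  rw [norm_mul, norm_mul, norm_mul, Complex.norm_I, one_mul, norm_ofReal_mul_add_one hζ,
    norm_sub_rev 1 ζ, hgn] at hn
  have hx : 1 + x ^ 2 = ‖(x : ℂ) + Complex.I‖ ^ 2 := by
    rw [← Complex.normSq_eq_norm_sq, Complex.normSq_apply]; simp; ring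
  have hxi : ‖(x : ℂ) + Complex.I‖ ≠ 0 := by
    intro h0
    rw [h0] at hx
    nlinarith [sq_nonneg x]
  have hζ1 : ‖ζ - 1‖ ≠ 0 := norm_ne_zero_iff.2 hne
  have hw : ‖ζ + (discCoord γ : ℂ)‖ ≠ 0 := by
    intro h0
    rw [h0, mul_zero] at hn
    exact mul_ne_zero hxi hζ1 hn
  have hl := congrArg Real.log hn
  rw [Real.log_mul hxi hζ1, Real.log_mul (by linarith) hw] at hl
  rw [hx, Real.log_pow]
  push_cast
  linarith

theorem circleIntegrable_log_norm_add (a : ℂ) :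
    CircleIntegrable (fun z => Real.log ‖z + a‖) 0 1 := by
  simpa using circleIntegrable_log_norm_sub_const (a := -a) (c := 0) 1

theorem circleIntegrable_log_norm_sub_one :
    CircleIntegrable (fun z : ℂ => Real.log ‖z - 1‖) 0 1 :=
  circleIntegrable_log_norm_sub_const (a := 1) (c := 0) 1

theorem integrable_log_one_add_sq {γ : ℝ≥0} (hγ : 0 < γ) :
    Integrable (fun x : ℝ => Real.log (1 + x ^ 2)) (cauchyMeasure 0 γ) := by
  refine integrable_cauchyMeasure_of_circleIntegrable hγ
    (fun x ζ hζ h => log_one_add_sq_eq (γ := γ) hγ hζ h) ?_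
  exact (((circleIntegrable_const _ _ _).add (circleIntegrable_log_norm_add _)).sub
    circleIntegrable_log_norm_sub_one).const_mul 2

/-- By Jensen's formula both logarithmic terms average to zero, as the points `-w` and `1` lie in
the closed unit disc. -/
theorem integral_log_one_add_sq {γ : ℝ≥0} (hγ : 0 < γ) :
    ∫ x : ℝ, Real.log (1 + x ^ 2) ∂(cauchyMeasure 0 γ) = 2 * Real.log (1 + γ) := by
  rw [integral_cauchyMeasure_eq_circleAverage hγ
    (fun x ζ hζ h => log_one_add_sq_eq (γ := γ) hγ hζ h)]
  have h1 : Real.circleAverage (fun z : ℂ => Real.log ‖z + (discCoord γ : ℂ)‖) 0 1 = 0 := by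
    rw [circleAverage_log_norm_add_const_eq_posLog, Real.posLog_eq_zero_iff]
    simpa using (abs_discCoord_lt_one (γ := γ) hγ).le
  have h2 : Real.circleAverage (fun z : ℂ => Real.log ‖z - 1‖) 0 1 = 0 :=
    circleAverage_log_norm_sub_const₁ (by simp)
  have hi : CircleIntegrable
      (fun z : ℂ => Real.log (1 + γ) + Real.log ‖z + (discCoord γ : ℂ)‖) 0 1 :=
    (circleIntegrable_const (Real.log (1 + γ)) (0 : ℂ) 1).add (circleIntegrable_log_norm_add _)
  have h3 := Real.circleAverage_fun_smul (𝕜 := ℝ) (a := 2) (c := (0 : ℂ)) (R := 1)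
    (f := fun z : ℂ => Real.log (1 + γ) + Real.log ‖z + (discCoord γ : ℂ)‖ - Real.log ‖z - 1‖)
  simp only [smul_eq_mul] at h3
  rw [h3, Real.circleAverage_fun_sub hi circleIntegrable_log_norm_sub_one,
    Real.circleAverage_fun_add (circleIntegrable_const _ _ _) (circleIntegrable_log_norm_add _),
    h1, h2, Real.circleAverage_const]
  ring

/-! ### Moments of the Cayley transform -/

/-- The Cayley transform, from the line to the unit circle. -/
noncomputable def cayley (x : ℝ) : ℂ := (x - Complex.I) / (x + Complex.I)

theorem ofReal_add_I_ne_zero (x : ℝ) : (x : ℂ) + Complex.I ≠ 0 := by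
  intro h
  simpa using congrArg Complex.im h

theorem conj_ofReal_add_I (x : ℝ) :
    (starRingEnd ℂ) ((x : ℂ) + Complex.I) = x - Complex.I := by
  simp [sub_eq_add_neg]

theorem norm_cayley (x : ℝ) : ‖cayley x‖ = 1 := by
  rw [cayley, ← conj_ofReal_add_I, norm_div, Complex.norm_conj,
    div_self (norm_ne_zero_iff.2 (ofReal_add_I_ne_zero x))]

theorem continuous_cayley : Continuous cayley := by
  unfold cayley
  exact Continuous.div (by fun_prop) (by fun_prop) ofReal_add_I_ne_zero

theorem cayley_injective : Function.Injective cayley := by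
  intro x y h
  rw [cayley, cayley, div_eq_div_iff (ofReal_add_I_ne_zero x) (ofReal_add_I_ne_zero y)] at h
  have h2 : (2 * Complex.I) * ((x : ℂ) - y) = 0 := by linear_combination h
  have h3 : (x : ℂ) - y = 0 := by simpa using h2
  exact_mod_cast sub_eq_zero.1 h3

theorem aestronglyMeasurable_cayley_pow (n : ℕ) (μ : Measure ℝ) :
    AEStronglyMeasurable (fun x => cayley x ^ n) μ :=
  (continuous_cayley.pow n).aestronglyMeasurable

/-- In the variable `ζ` the Cayley transform is the Blaschke factor `(w + ζ) / (1 + w ζ)`,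
holomorphic up to the boundary, so its powers average to their values at `0`. -/
theorem integral_cayley_pow {γ : ℝ≥0} (hγ : 0 < γ) (n : ℕ) :
    ∫ x, cayley x ^ n ∂(cauchyMeasure 0 γ) = (discCoord γ : ℂ) ^ n := by
  have hw := abs_discCoord_lt_one (γ := γ) hγ
  have hg1 : ((γ : ℂ) + 1) ≠ 0 := by
    have : ((γ : ℝ) + 1 : ℝ) ≠ 0 := by positivity
    exact_mod_cast this
  have hden : ∀ ζ : ℂ, ‖ζ‖ ≤ 1 → 1 + (discCoord γ : ℂ) * ζ ≠ 0 := by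
    intro ζ hζ h0
    have h1 : (discCoord γ : ℂ) * ζ = -1 := by linear_combination h0
    have h2 := congrArg norm h1
    rw [norm_mul, norm_neg, norm_one, Complex.norm_real, Real.norm_eq_abs] at h2
    nlinarith [abs_nonneg (discCoord γ), norm_nonneg ζ]
  rw [integral_cauchyMeasure_eq_circleAverage hγ
    (g := fun ζ => ((discCoord γ + ζ) / (1 + discCoord γ * ζ)) ^ n)]
  · have hd : DiffContOnCl ℂ (fun ζ : ℂ => ((discCoord γ + ζ) / (1 + discCoord γ * ζ)) ^ n)
        (Metric.ball 0 |1|) := by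
      refine DifferentiableOn.diffContOnCl fun ζ hζ => ?_
      rw [abs_one, closure_ball _ one_ne_zero, mem_closedBall_zero_iff] at hζ
      have := hden ζ hζ
      exact (by fun_prop (disch := assumption) :
        DifferentiableAt ℂ (fun ζ : ℂ => ((discCoord γ + ζ) / (1 + discCoord γ * ζ)) ^ n) ζ)
          |>.differentiableWithinAt
    rw [hd.circleAverage]
    simp
  · intro x ζ hζ h
    congr 1
    have hne : (1 : ℂ) - ζ ≠ 0 := by
      intro h0
      have hz : ζ = 1 := by linear_combination -h0
      rw [hz] at h
      have : Complex.I * (γ : ℂ) = 0 := by linear_combination -h / 2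
      simp [hγ.ne'] at this
    rw [cayley, div_eq_div_iff (ofReal_add_I_ne_zero x) (hden ζ hζ.le)]
    apply mul_left_cancel₀ hne
    apply mul_left_cancel₀ hg1
    have e : ((γ : ℂ) + 1) * (discCoord γ : ℂ) = γ - 1 := by
      rw [discCoord]; push_cast; field_simp
    linear_combination (((γ : ℂ) + 1) - ((γ : ℂ) + 1) * ζ) * h
      + (((1 - ζ) * (x - Complex.I) * ζ) - (1 - ζ) * (x + Complex.I)) * e
      + (γ - 1 : ℂ) * (ζ - 1) * h

open BoundedContinuousFunction in
/-- A probability measure on the line is determined by the moments of its Cayley transform. -/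
theorem ext_of_integral_cayley_pow {μ ν : Measure ℝ} [IsFiniteMeasure μ] [IsFiniteMeasure ν]
    (h : ∀ n : ℕ, ∫ x, cayley x ^ n ∂μ = ∫ x, cayley x ^ n ∂ν) : μ = ν := by
  let c : ℝ →ᵇ ℂ := BoundedContinuousFunction.ofNormedAddCommGroup cayley continuous_cayley 1
    fun x => (norm_cayley x).le
  have hc : ∀ x, c x = cayley x := fun x => rfl
  refine ext_of_forall_mem_subalgebra_integral_eq_of_polish
    (A := StarAlgebra.adjoin ℂ {c}) ?_ ?_
  · intro x y hxy
    refine ⟨c, ⟨_, ⟨c, StarAlgebra.subset_adjoin ℂ _ rfl, rfl⟩, rfl⟩, ?_⟩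
    exact fun hh => hxy (cayley_injective hh)
  · intro g hg
    have hspan : g ∈ Submodule.span ℂ (Submonoid.closure ({c, star c} : Set (ℝ →ᵇ ℂ)) : Set _) := by
      rw [← Algebra.adjoin_eq_span]
      have h2 : g ∈ (StarAlgebra.adjoin ℂ {c}).toSubalgebra := hg
      rw [StarAlgebra.adjoin_toSubalgebra, Set.star_singleton, Set.singleton_union] at h2
      exact h2
    induction hspan using Submodule.span_induction with
    | mem z hz =>
      obtain ⟨m, n, rfl⟩ := (Submonoid.mem_closure_pair _ _ _).1 hz
      -- On the unit circle conjugation is inversion, so each monomial collapses to a power of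
      -- `cayley` or the conjugate of one.
      have hunit : ∀ x, cayley x * (starRingEnd ℂ) (cayley x) = 1 := fun x => by
        rw [Complex.mul_conj, Complex.normSq_eq_norm_sq, norm_cayley]; simp
      have hval : ∀ x, (c ^ m * star c ^ n) x = cayley x ^ m * (starRingEnd ℂ) (cayley x) ^ n :=
        fun x => rfl
      simp only [hval]
      rcases le_total n m with hnm | hnm
      · obtain ⟨k, rfl⟩ := Nat.exists_eq_add_of_le hnm
        have e : ∀ x, cayley x ^ (n + k) * (starRingEnd ℂ) (cayley x) ^ n = cayley x ^ k := by
          intro x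
          rw [pow_add, mul_right_comm, ← mul_pow, hunit, one_pow, one_mul]
        simp only [e, h]
      · obtain ⟨k, rfl⟩ := Nat.exists_eq_add_of_le hnm
        have e : ∀ x, cayley x ^ m * (starRingEnd ℂ) (cayley x) ^ (m + k)
            = (starRingEnd ℂ) (cayley x ^ k) := by
          intro x
          rw [pow_add, ← mul_assoc, ← mul_pow, hunit, one_pow, one_mul, map_pow]
        simp only [e, integral_conj, h]
    | zero => simp
    | add x y hx hy ihx ihy =>
      have key : ∀ ρ : Measure ℝ, IsFiniteMeasure ρ →
          ∫ t, (x + y) t ∂ρ = ∫ t, x t ∂ρ + ∫ t, y t ∂ρ := fun ρ _ =>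
        integral_add (x.integrable ρ) (y.integrable ρ)
      have hmem : ∀ z, z ∈ Submodule.span ℂ
          (Submonoid.closure ({c, star c} : Set (ℝ →ᵇ ℂ)) : Set _) →
          z ∈ StarAlgebra.adjoin ℂ {c} := by
        intro z hz
        rw [← Algebra.adjoin_eq_span] at hz
        change z ∈ (StarAlgebra.adjoin ℂ {c}).toSubalgebra
        rw [StarAlgebra.adjoin_toSubalgebra, Set.star_singleton, Set.singleton_union]
        exact hz
      rw [key μ inferInstance, key ν inferInstance, ihx (hmem _ hx), ihy (hmem _ hy)]
    | smul a x hx ihx =>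
      have hmem : x ∈ StarAlgebra.adjoin ℂ {c} := by
        rw [← Algebra.adjoin_eq_span] at hx
        change x ∈ (StarAlgebra.adjoin ℂ {c}).toSubalgebra
        rw [StarAlgebra.adjoin_toSubalgebra, Set.star_singleton, Set.singleton_union]
        exact hx
      have key : ∀ ρ : Measure ℝ, ∫ t, (a • x) t ∂ρ = a • ∫ t, x t ∂ρ := fun ρ =>
        integral_smul a _
      rw [key, key, ihx hmem]

theorem eq_of_cauchyMeasure_eq {γ γ' : ℝ≥0} (hγ : 0 < γ) (hγ' : 0 < γ')
    (h : cauchyMeasure 0 γ = cauchyMeasure 0 γ') : γ = γ' := by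
  have h1 := integral_log_one_add_sq hγ
  rw [h, integral_log_one_add_sq hγ'] at h1
  have h2 : Real.log (1 + γ') = Real.log (1 + γ) := by linarith
  have h3 := Real.log_injOn_pos (Set.mem_Ioi.2 (by positivity)) (Set.mem_Ioi.2 (by positivity)) h2
  exact NNReal.eq (by linarith)

theorem measurePreserving_mul_left_cauchyMeasure {a γ : ℝ≥0} (ha : 0 < a) (hγ : 0 < γ) :
    MeasurePreserving (fun x : ℝ => a * x) (cauchyMeasure 0 γ) (cauchyMeasure 0 (a * γ)) := by
  have hm : Measurable (fun x : ℝ => (a : ℝ) * x) := by fun_prop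
  refine ⟨hm, ?_⟩
  have := Measure.isProbabilityMeasure_map (μ := cauchyMeasure 0 γ) hm.aemeasurable
  refine ext_of_integral_cayley_pow fun n => ?_
  rw [integral_map hm.aemeasurable (aestronglyMeasurable_cayley_pow n _),
    integral_cauchyMeasure hγ, integral_cauchyMeasure (mul_pos ha hγ)]
  simp only [cauchyParam, NNReal.coe_mul, mul_assoc]

/-! ### The action of `cotAngle` on Cauchy laws, and its derivative -/

/-- The poles of `cotAngle K`. -/
def poles (K : ℕ) : Set ℝ := {x | (((x : ℂ) + Complex.I) ^ K).im = 0}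

theorem conj_ofReal_add_I_pow (K : ℕ) (x : ℝ) :
    (starRingEnd ℂ) (((x : ℂ) + Complex.I) ^ K) = cayley x ^ K * ((x : ℂ) + Complex.I) ^ K := by
  rw [map_pow, conj_ofReal_add_I, ← mul_pow, cayley, div_mul_cancel₀ _ (ofReal_add_I_ne_zero x)]

/-- At a pole `(x + i) ^ K` is real, which forces `cayley x ^ K = 1`; there are finitely many such
roots and `cayley` is injective. -/
theorem finite_poles {K : ℕ} (hK : 0 < K) : (poles K).Finite := by
  refine Set.Finite.subset (Set.Finite.preimage cayley_injective.injOn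
    (Polynomial.nthRoots K (1 : ℂ)).toFinset.finite_toSet) fun x hx => ?_
  have h1 := conj_ofReal_add_I_pow K x
  rw [Complex.conj_eq_iff_im.2 hx] at h1
  have h2 := pow_ne_zero K (ofReal_add_I_ne_zero x)
  have h3 : cayley x ^ K = 1 := mul_right_cancel₀ h2 (by rw [← h1, one_mul])
  simpa [Polynomial.mem_nthRoots hK] using h3

/-- With `z = (x + i) ^ K` both sides equal `conj z / z`. Poles are excluded: there the default
value `0` of `cotAngle` has Cayley image `-1`, not `1`. -/
theorem cayley_cotAngle {K : ℕ} {x : ℝ} (hx : x ∉ poles K) :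
    cayley (cotAngle K x) = cayley x ^ K := by
  have hz := pow_ne_zero K (ofReal_add_I_ne_zero x)
  have hc := conj_ofReal_add_I_pow K x
  have him : ((((x : ℂ) + Complex.I) ^ K).im : ℂ) ≠ 0 := by exact_mod_cast hx
  rw [cayley, div_eq_iff (ofReal_add_I_ne_zero _), cotAngle]
  set z := ((x : ℂ) + Complex.I) ^ K
  have e1 : z = z.re + z.im * Complex.I := (Complex.re_add_im z).symm
  have e2 : (starRingEnd ℂ) z = z.re - z.im * Complex.I := by
    apply Complex.ext <;> simp
  push_cast
  field_simp
  calc (z.re : ℂ) - z.im * Complex.I = (starRingEnd ℂ) z := e2.symm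
    _ = cayley x ^ K * z := hc
    _ = cayley x ^ K * (z.re + z.im * Complex.I) := by rw [← e1]
    _ = _ := by ring

theorem measurable_cotAngle (K : ℕ) : Measurable (cotAngle K) := by
  unfold cotAngle
  have h : Continuous fun x : ℝ => ((x : ℂ) + Complex.I) ^ K := by fun_prop
  exact (Complex.measurable_re.comp h.measurable).div (Complex.measurable_im.comp h.measurable)

theorem cauchyMeasure_absolutelyContinuous {γ : ℝ≥0} (hγ : 0 < γ) :
    cauchyMeasure 0 γ ≪ volume := by
  rw [cauchyMeasure_of_scale_ne_zero _ hγ.ne']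
  exact withDensity_absolutelyContinuous _ _

theorem absolutelyContinuous_cauchyMeasure {γ : ℝ≥0} (hγ : 0 < γ) :
    volume ≪ cauchyMeasure 0 γ := by
  rw [cauchyMeasure_of_scale_ne_zero _ hγ.ne']
  refine withDensity_absolutelyContinuous' (measurable_cauchyPDF _ _).aemeasurable
    (ae_of_all _ fun x => ?_)
  exact (ENNReal.ofReal_pos.2 (cauchyPDF_pos 0 hγ.ne' x)).ne'

theorem ae_notMem_poles {K : ℕ} (hK : 0 < K) {γ : ℝ≥0} (hγ : 0 < γ) :
    ∀ᵐ x ∂(cauchyMeasure 0 γ), x ∉ poles K :=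
  (cauchyMeasure_absolutelyContinuous hγ).ae_le
    (measure_eq_zero_iff_ae_notMem.1 ((finite_poles hK).measure_zero _))

theorem measurePreserving_cotAngle {K : ℕ} (hK : 0 < K) {γ γ' : ℝ≥0} (hγ : 0 < γ) (hγ' : 0 < γ')
    (h : discCoord γ' = discCoord γ ^ K) :
    MeasurePreserving (cotAngle K) (cauchyMeasure 0 γ) (cauchyMeasure 0 γ') := by
  have hm := measurable_cotAngle K
  refine ⟨hm, ?_⟩
  have := Measure.isProbabilityMeasure_map (μ := cauchyMeasure 0 γ) hm.aemeasurable
  refine ext_of_integral_cayley_pow fun n => ?_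
  rw [integral_map hm.aemeasurable (aestronglyMeasurable_cayley_pow n _),
    integral_cayley_pow hγ', h]
  rw [integral_congr_ae (g := fun x => cayley x ^ (K * n))]
  · rw [integral_cayley_pow hγ, pow_mul]
    push_cast
    rfl
  · filter_upwards [ae_notMem_poles hK hγ] with x hx
    rw [cayley_cotAngle hx, pow_mul]

theorem hasDerivAt_ofReal_add_I_pow (K : ℕ) (x : ℝ) :
    HasDerivAt (fun y : ℝ => ((y : ℂ) + Complex.I) ^ K) (K * ((x : ℂ) + Complex.I) ^ (K - 1)) x := by
  have h := (((hasDerivAt_id (x : ℂ)).add_const Complex.I).pow K).comp_ofReal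
  simpa using h

theorem hasDerivAt_cotAngle {K : ℕ} (hK : 0 < K) {x : ℝ} (hx : x ∉ poles K) :
    HasDerivAt (cotAngle K) (K * (1 + cotAngle K x ^ 2) / (1 + x ^ 2)) x := by
  have hd := hasDerivAt_ofReal_add_I_pow K x
  have hre : HasDerivAt (fun y : ℝ => (((y : ℂ) + Complex.I) ^ K).re)
      (K * ((x : ℂ) + Complex.I) ^ (K - 1)).re x :=
    Complex.reCLM.hasFDerivAt.comp_hasDerivAt x hd
  have him : HasDerivAt (fun y : ℝ => (((y : ℂ) + Complex.I) ^ K).im)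
      (K * ((x : ℂ) + Complex.I) ^ (K - 1)).im x :=
    Complex.imCLM.hasFDerivAt.comp_hasDerivAt x hd
  have hx' : (((x : ℂ) + Complex.I) ^ K).im ≠ 0 := hx
  have hz : ((x : ℂ) + Complex.I) ^ K
      = ((x : ℂ) + Complex.I) ^ (K - 1) * ((x : ℂ) + Complex.I) := by
    rw [← pow_succ, Nat.sub_add_cancel hK]
  refine (hre.div him hx').congr_deriv ?_
  rw [cotAngle]
  have hxx : 1 + x ^ 2 ≠ 0 := by positivity
  have er := congrArg Complex.re hz
  have ei := congrArg Complex.im hz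
  simp only [Complex.mul_re, Complex.mul_im, Complex.add_re, Complex.add_im, Complex.ofReal_re,
    Complex.ofReal_im, Complex.I_re, Complex.I_im, add_zero, zero_add, mul_one] at er ei
  rw [Complex.mul_re, Complex.mul_im, Complex.natCast_re, Complex.natCast_im]
  set a := (((x : ℂ) + Complex.I) ^ K).re
  set b := (((x : ℂ) + Complex.I) ^ K).im
  set p := (((x : ℂ) + Complex.I) ^ (K - 1)).re
  set q := (((x : ℂ) + Complex.I) ^ (K - 1)).im
  field_simp
  rw [er, ei]
  ring

theorem deriv_sgb {K : ℕ} (hK : 0 < K) (α : ℝ) {x : ℝ} (hx : x ∉ poles K) :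
    deriv (sgb K α) x = α * K ^ 2 * ((1 + cotAngle K x ^ 2) / (1 + x ^ 2)) := by
  have h : HasDerivAt (sgb K α) _ x := (hasDerivAt_cotAngle hK hx).const_mul (α * K)
  rw [h.deriv]
  ring

theorem logAbsDeriv_eq {K : ℕ} (hK : 0 < K) {α : ℝ} (hα : 0 < α) {x : ℝ} (hx : x ∉ poles K) :
    logAbsDeriv K α x = Real.log (α * K ^ 2) + Real.log (1 + cotAngle K x ^ 2)
      - Real.log (1 + x ^ 2) := by
  have hK' : (0 : ℝ) < K := by exact_mod_cast hK
  rw [logAbsDeriv, deriv_sgb hK α hx, abs_of_pos (by positivity),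
    Real.log_mul (by positivity) (by positivity), Real.log_div (by positivity) (by positivity)]
  ring

/-- The term `log (1 + F_K ^ 2)` is transported by `h` to `log (1 + y ^ 2)` against the image law,
so both integrals are known. -/
theorem integral_logAbsDeriv {K : ℕ} (hK : 0 < K) {α : ℝ} (hα : 0 < α) {γ γ' : ℝ≥0} (hγ : 0 < γ)
    (hγ' : 0 < γ') (h : MeasurePreserving (cotAngle K) (cauchyMeasure 0 γ) (cauchyMeasure 0 γ')) :
    Integrable (logAbsDeriv K α) (cauchyMeasure 0 γ) ∧
    ∫ x, logAbsDeriv K α x ∂(cauchyMeasure 0 γ)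
      = Real.log (α * K ^ 2) + 2 * Real.log (1 + γ') - 2 * Real.log (1 + γ) := by
  have hae : logAbsDeriv K α =ᵐ[cauchyMeasure 0 γ] fun x => Real.log (α * K ^ 2)
      + Real.log (1 + cotAngle K x ^ 2) - Real.log (1 + x ^ 2) := by
    filter_upwards [ae_notMem_poles hK hγ] with x hx using logAbsDeriv_eq hK hα hx
  have hm : AEStronglyMeasurable (fun x : ℝ => Real.log (1 + x ^ 2)) (cauchyMeasure 0 γ') :=
    (integrable_log_one_add_sq hγ').aestronglyMeasurable
  have hi : Integrable (fun x => Real.log (1 + cotAngle K x ^ 2)) (cauchyMeasure 0 γ) :=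
    (h.integrable_comp hm).2 (integrable_log_one_add_sq hγ')
  have hv : ∫ x, Real.log (1 + cotAngle K x ^ 2) ∂(cauchyMeasure 0 γ)
      = 2 * Real.log (1 + γ') := by
    rw [← integral_log_one_add_sq hγ', ← h.map_eq]
    rw [← h.map_eq] at hm
    exact (integral_map h.measurable.aemeasurable hm).symm
  have hi' : Integrable (fun x => Real.log (α * K ^ 2) + Real.log (1 + cotAngle K x ^ 2))
      (cauchyMeasure 0 γ) := (integrable_const _).add hi
  refine ⟨(hi'.sub (integrable_log_one_add_sq hγ)).congr hae.symm, ?_⟩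
  rw [integral_congr_ae hae, integral_sub hi' (integrable_log_one_add_sq hγ),
    integral_add (integrable_const _) hi, hv, integral_log_one_add_sq hγ]
  simp

/-! ### Behaviour at infinity and tangency -/

theorem tendsto_inv_cocompact : Tendsto (fun x : ℝ => x⁻¹) (cocompact ℝ) (𝓝[≠] 0) := by
  rw [← Metric.cobounded_eq_cocompact]
  exact tendsto_inv₀_cobounded'

theorem eventually_notMem_poles {K : ℕ} (hK : 0 < K) : ∀ᶠ x in cocompact ℝ, x ∉ poles K :=
  (finite_poles hK).isCompact.compl_mem_cocompact

theorem eventually_ne_zero_cocompact : ∀ᶠ x : ℝ in cocompact ℝ, x ≠ 0 :=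
  isCompact_singleton.compl_mem_cocompact

/-- In terms of `t = x⁻¹` the denominator is a difference quotient at `t = 0`; this explains the
form `(x⁻¹)⁻¹`. -/
theorem cotAngle_div_self (K : ℕ) {x : ℝ} (hx : x ≠ 0) :
    cotAngle K x / x = ((1 + (x⁻¹ : ℝ) * Complex.I) ^ K).re
      / ((x⁻¹)⁻¹ * ((1 + (x⁻¹ : ℝ) * Complex.I) ^ K).im) := by
  have hx' : (x : ℂ) ≠ 0 := by exact_mod_cast hx
  have h : ((x : ℂ) + Complex.I) ^ K
      = ((x ^ K : ℝ) : ℂ) * (1 + (x⁻¹ : ℝ) * Complex.I) ^ K := by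
    push_cast
    rw [← mul_pow]
    congr 1
    field_simp
  rw [cotAngle, h, Complex.re_ofReal_mul, Complex.im_ofReal_mul,
    mul_div_mul_left _ _ (pow_ne_zero K hx), inv_inv, div_div, mul_comm x]

theorem tendsto_cotAngle_div_self {K : ℕ} (hK : 0 < K) :
    Tendsto (fun x => cotAngle K x / x) (cocompact ℝ) (𝓝 (1 / K)) := by
  have hd : HasDerivAt (fun t : ℝ => (1 + (t : ℂ) * Complex.I) ^ K) (K * Complex.I) 0 := by
    have h := ((((hasDerivAt_id ((0 : ℝ) : ℂ)).mul_const Complex.I).const_add 1).pow K).comp_ofReal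
    simpa using h
  have him : HasDerivAt (fun t : ℝ => ((1 + (t : ℂ) * Complex.I) ^ K).im) (K * Complex.I).im 0 :=
    Complex.imCLM.hasFDerivAt.comp_hasDerivAt 0 hd
  have h1 : Tendsto (fun t : ℝ => t⁻¹ * ((1 + (t : ℂ) * Complex.I) ^ K).im) (𝓝[≠] 0)
      (𝓝 K) := by
    simpa using him.tendsto_slope_zero
  have hc : Continuous fun t : ℝ => ((1 + (t : ℂ) * Complex.I) ^ K).re :=
    Complex.continuous_re.comp (by fun_prop)
  have h2 : Tendsto (fun t : ℝ => ((1 + (t : ℂ) * Complex.I) ^ K).re) (𝓝[≠] 0) (𝓝 1) := by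
    simpa using (hc.tendsto 0).mono_left nhdsWithin_le_nhds
  have hK' : (K : ℝ) ≠ 0 := by exact_mod_cast hK.ne'
  refine ((h2.div h1 hK').comp tendsto_inv_cocompact).congr' ?_
  filter_upwards [eventually_ne_zero_cocompact] with x hx
  exact (cotAngle_div_self K hx).symm

theorem tendsto_deriv_sgb {K : ℕ} (hK : 0 < K) (α : ℝ) :
    Tendsto (deriv (sgb K α)) (cocompact ℝ) (𝓝 α) := by
  have hK' : (K : ℝ) ≠ 0 := by exact_mod_cast hK.ne'
  have hi : Tendsto (fun x : ℝ => x⁻¹ ^ 2) (cocompact ℝ) (𝓝 0) := by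
    simpa using ((tendsto_inv_cocompact.mono_right nhdsWithin_le_nhds).pow 2)
  have h := (((hi.add ((tendsto_cotAngle_div_self hK).pow 2)).div
    (hi.add_const 1) (by norm_num))).const_mul (α * K ^ 2)
  have e : α * (K : ℝ) ^ 2 * ((0 + (1 / (K : ℝ)) ^ 2) / (0 + 1)) = α := by
    field_simp
    ring
  rw [e] at h
  refine h.congr' ?_
  filter_upwards [eventually_ne_zero_cocompact, eventually_notMem_poles hK] with x hx hp
  rw [deriv_sgb hK α hp]
  congr 1
  simp only [Pi.div_apply]
  field_simp

theorem tendsto_sgb_cocompact {K : ℕ} (hK : 0 < K) {α : ℝ} (hα : 0 < α) :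
    Tendsto (sgb K α) (cocompact ℝ) (cocompact ℝ) := by
  have hK' : (0 : ℝ) < K := by exact_mod_cast hK
  rw [← Metric.cobounded_eq_cocompact (α := ℝ), ← tendsto_norm_atTop_iff_cobounded,
    Metric.cobounded_eq_cocompact]
  have h1 := ((tendsto_cotAngle_div_self hK).const_mul (α * K)).norm
  have h2 := h1.pos_mul_atTop (norm_pos_iff.2 (by positivity)) (tendsto_norm_cocompact_atTop (E := ℝ))
  refine h2.congr' ?_
  filter_upwards [eventually_ne_zero_cocompact] with x hx
  rw [← norm_mul, sgb]
  congr 1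
  field_simp

theorem isTangentAt_zero {K : ℕ} (hK : Odd K) : IsTangentAt (sgb K (1 / (K : ℝ) ^ 2)) 0 := by
  have hK0 : 0 < K := hK.pos
  have hK' : (K : ℝ) ≠ 0 := by exact_mod_cast hK0.ne'
  have hre : (Complex.I ^ K).re = 0 ∧ (Complex.I ^ K).im ≠ 0 := by
    obtain ⟨m, rfl⟩ := hK
    rw [pow_succ, pow_mul, Complex.I_sq]
    have : ((-1 : ℂ) ^ m) = (((-1 : ℝ) ^ m : ℝ) : ℂ) := by push_cast; rfl
    rw [this, Complex.re_ofReal_mul, Complex.im_ofReal_mul]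
    simp
  have hp : (0 : ℝ) ∉ poles K := by
    simpa [poles] using hre.2
  have h0 : cotAngle K 0 = 0 := by simp [cotAngle, hre.1]
  refine ⟨by simp [sgb, h0], ?_⟩
  have h : HasDerivAt (sgb K (1 / (K : ℝ) ^ 2)) _ 0 :=
    (hasDerivAt_cotAngle hK0 hp).const_mul (1 / (K : ℝ) ^ 2 * K)
  refine h.congr_deriv ?_
  rw [h0]
  field_simp

/-! ### The equation for the invariant scale -/

/-- The scale of the Cauchy law with disc coordinate `v`; the inverse of `discCoord`. -/
noncomputable def ofDisc (v : ℝ) : ℝ := (1 + v) / (1 - v)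

theorem ofDisc_pos {v : ℝ} (hv : |v| < 1) : 0 < ofDisc v := by
  have := abs_lt.1 hv
  exact div_pos (by linarith) (by linarith)

theorem discCoord_ofDisc {v : ℝ} (hv : |v| < 1) : discCoord (ofDisc v) = v := by
  have := abs_lt.1 hv
  have h : 1 - v ≠ 0 := by linarith
  rw [discCoord, ofDisc]
  field_simp
  ring

theorem ofDisc_discCoord {γ : ℝ} (hγ : 0 < γ) : ofDisc (discCoord γ) = γ := by
  have h : γ + 1 ≠ 0 := by linarith
  rw [discCoord, ofDisc]
  field_simp
  ring

theorem abs_pow_lt_one {K : ℕ} (hK : 0 < K) {w : ℝ} (hw : |w| < 1) : |w ^ K| < 1 := by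
  rw [abs_pow]
  exact pow_lt_one₀ (abs_nonneg _) hw hK.ne'

/-- The map that `cotAngle K` induces on the scales of centred Cauchy laws. -/
noncomputable def pushScale (K : ℕ) (γ : ℝ≥0) : ℝ≥0 := (ofDisc (discCoord γ ^ K)).toNNReal

theorem coe_pushScale {K : ℕ} (hK : 0 < K) {γ : ℝ≥0} (hγ : 0 < γ) :
    (pushScale K γ : ℝ) = ofDisc (discCoord γ ^ K) :=
  Real.coe_toNNReal _ (ofDisc_pos (abs_pow_lt_one hK (abs_discCoord_lt_one (γ := γ) hγ))).le

theorem pushScale_pos {K : ℕ} (hK : 0 < K) {γ : ℝ≥0} (hγ : 0 < γ) : 0 < pushScale K γ :=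
  Real.toNNReal_pos.2 (ofDisc_pos (abs_pow_lt_one hK (abs_discCoord_lt_one (γ := γ) hγ)))

theorem measurePreserving_cotAngle_pushScale {K : ℕ} (hK : 0 < K) {γ : ℝ≥0} (hγ : 0 < γ) :
    MeasurePreserving (cotAngle K) (cauchyMeasure 0 γ) (cauchyMeasure 0 (pushScale K γ)) := by
  refine measurePreserving_cotAngle hK hγ (pushScale_pos hK hγ) ?_
  rw [coe_pushScale hK hγ, discCoord_ofDisc (abs_pow_lt_one hK (abs_discCoord_lt_one (γ := γ) hγ))]

theorem measurePreserving_sgb {K : ℕ} (hK : 0 < K) {α : ℝ} (hα : 0 < α) {γ : ℝ≥0} (hγ : 0 < γ) :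
    MeasurePreserving (sgb K α) (cauchyMeasure 0 γ)
      (cauchyMeasure 0 (α.toNNReal * K * pushScale K γ)) := by
  have ha : 0 < α.toNNReal * (K : ℝ≥0) :=
    mul_pos (Real.toNNReal_pos.2 hα) (by exact_mod_cast hK)
  have h := (measurePreserving_mul_left_cauchyMeasure ha (pushScale_pos hK hγ)).comp
    (measurePreserving_cotAngle_pushScale hK hγ)
  have e : (fun x : ℝ => ((α.toNNReal * K : ℝ≥0) : ℝ) * x) ∘ cotAngle K = sgb K α := by
    ext x
    simp [sgb, hα.le]
  rwa [e] at h

/-- The ratio of `ofDisc w` and `ofDisc (w ^ K)`; the Cauchy law with disc coordinate `w` is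
invariant under `sgb K α` when it equals `α * K`. -/
noncomputable def scaleRatio (K : ℕ) (w : ℝ) : ℝ :=
  ((1 + w) * (1 - w ^ K)) / ((1 - w) * (1 + w ^ K))

theorem ofDisc_eq_scaleRatio_mul {K : ℕ} (hK : 0 < K) {w : ℝ} (hw : |w| < 1) :
    ofDisc w = scaleRatio K w * ofDisc (w ^ K) := by
  have h1 := abs_lt.1 hw
  have h2 := abs_lt.1 (abs_pow_lt_one hK hw)
  have h3 : 1 - w ≠ 0 := by linarith
  have h4 : 1 - w ^ K ≠ 0 := by linarith
  have h5 : 1 + w ^ K ≠ 0 := by linarith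
  rw [ofDisc, ofDisc, scaleRatio]
  field_simp

theorem isInvariantScale_iff {K : ℕ} (hK : 0 < K) {α : ℝ} (hα : 0 < α) {γ : ℝ≥0} (hγ : 0 < γ) :
    IsInvariantScale K α γ ↔ scaleRatio K (discCoord γ) = α * K := by
  have hw := abs_discCoord_lt_one (γ := γ) hγ
  have hK' : (0 : ℝ≥0) < K := by exact_mod_cast hK
  have hp : 0 < α.toNNReal * K * pushScale K γ :=
    mul_pos (mul_pos (Real.toNNReal_pos.2 hα) hK') (pushScale_pos hK hγ)
  have hS := measurePreserving_sgb hK hα hγ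
  have hv := ofDisc_pos (abs_pow_lt_one hK hw)
  have e : scaleRatio K (discCoord γ) = α * K ↔ α.toNNReal * K * pushScale K γ = γ := by
    rw [← NNReal.coe_inj]
    push_cast
    rw [coe_pushScale hK hγ, Real.coe_toNNReal _ hα.le]
    have := ofDisc_eq_scaleRatio_mul hK hw
    rw [ofDisc_discCoord (γ := γ) hγ] at this
    constructor
    · intro h; rw [← h, ← this]
    · intro h; exact mul_right_cancel₀ hv.ne' (by rw [← this, h])
  rw [e]
  constructor
  · intro h
    exact eq_of_cauchyMeasure_eq hp hγ (hS.map_eq.symm.trans h.2.map_eq)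
  · intro h
    rw [h] at hS
    exact ⟨hγ, hS⟩

/-- Pair the exponents `j` and `K - 1 - j` and use `2ab ≤ a ^ 2 + b ^ 2`; the pair with `j = 0` is
strict because `|w ^ (K - 1)| < 1`. -/
theorem mul_pow_lt_sum_pow_two_mul {K : ℕ} (hK : 2 ≤ K) {w : ℝ} (hw : |w| < 1) :
    K * w ^ (K - 1) < ∑ j ∈ Finset.range K, w ^ (2 * j) := by
  have hsum : 2 * ∑ j ∈ Finset.range K, w ^ (2 * j)
      = ∑ j ∈ Finset.range K, (w ^ (2 * j) + w ^ (2 * (K - 1 - j))) := by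
    rw [Finset.sum_add_distrib, Finset.sum_range_reflect (fun j => w ^ (2 * j)) K]
    ring
  have hconst : (2 : ℝ) * (K * w ^ (K - 1)) = ∑ j ∈ Finset.range K, 2 * w ^ (K - 1) := by
    simp; ring
  have hsq : ∀ j ∈ Finset.range K, w ^ (2 * j) + w ^ (2 * (K - 1 - j)) - 2 * w ^ (K - 1)
      = (w ^ j - w ^ (K - 1 - j)) ^ 2 := by
    intro j hj
    have : K - 1 = j + (K - 1 - j) := by have := Finset.mem_range.1 hj; omega
    have e : w ^ (K - 1) = w ^ j * w ^ (K - 1 - j) := by rw [← pow_add, ← this]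
    rw [e, mul_comm 2 j, mul_comm 2 (K - 1 - j), pow_mul, pow_mul]
    ring
  have hlt : ∑ j ∈ Finset.range K, 2 * w ^ (K - 1)
      < ∑ j ∈ Finset.range K, (w ^ (2 * j) + w ^ (2 * (K - 1 - j))) := by
    refine Finset.sum_lt_sum (fun j hj => ?_) ⟨0, Finset.mem_range.2 (by omega), ?_⟩
    · linarith [hsq j hj, sq_nonneg (w ^ j - w ^ (K - 1 - j))]
    · have h0 := hsq 0 (Finset.mem_range.2 (by omega))
      have h1 := abs_lt.1 (abs_pow_lt_one (K := K - 1 - 0) (by omega) hw)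
      have h2 : 0 < (w ^ 0 - w ^ (K - 1 - 0)) ^ 2 := by
        rw [pow_zero]
        exact pow_pos (by linarith [h1.2]) 2
      linarith
  linarith

/-- The numerator of the derivative is `2 (1 - w ^ 2) (∑ w ^ (2j) - K w ^ (K - 1))`, positive by the
preceding inequality. -/
theorem strictMonoOn_scaleRatio {K : ℕ} (hK : 2 ≤ K) :
    StrictMonoOn (scaleRatio K) (Set.Ioo (-1) 1) := by
  have hd : ∀ w ∈ Set.Ioo (-1 : ℝ) 1, HasDerivAt (scaleRatio K)
      ((2 * (1 - w ^ (2 * K)) - 2 * K * w ^ (K - 1) * (1 - w ^ 2))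
        / ((1 - w) * (1 + w ^ K)) ^ 2) w := by
    intro w hw
    have h2 := abs_lt.1 (abs_pow_lt_one (K := K) (by omega) (abs_lt.2 hw))
    have hne : (1 - w) * (1 + w ^ K) ≠ 0 :=
      mul_ne_zero (by linarith [hw.2]) (by linarith)
    have hp := hasDerivAt_pow K w
    have hn := ((hasDerivAt_id w).const_add 1).mul (hp.const_sub 1)
    have hdn := ((hasDerivAt_id w).const_sub 1).mul (hp.const_add 1)
    refine (hn.div hdn hne).congr_deriv ?_
    congr 1
    simp only [id, Pi.mul_apply]
    rw [show 2 * K = K + K by ring, pow_add]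
    ring
  refine strictMonoOn_of_deriv_pos (convex_Ioo _ _)
    (fun w hw => (hd w hw).continuousAt.continuousWithinAt) fun w hw => ?_
  rw [interior_Ioo] at hw
  rw [(hd w hw).deriv]
  have h2 := abs_lt.1 (abs_pow_lt_one (K := K) (by omega) (abs_lt.2 hw))
  have hne : (1 - w) * (1 + w ^ K) ≠ 0 :=
    mul_ne_zero (by linarith [hw.2]) (by linarith)
  refine div_pos ?_ (by positivity)
  have hg := geom_sum_mul_neg (w ^ 2) K
  simp only [← pow_mul] at hg
  have hw2 : 0 < 1 - w ^ 2 := by nlinarith [hw.1, hw.2]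
  have := mul_lt_mul_of_pos_right (mul_pow_lt_sum_pow_two_mul hK (abs_lt.2 hw)) hw2
  rw [hg] at this
  linarith

theorem scaleRatio_neg {K : ℕ} (hK : Odd K) (w : ℝ) : scaleRatio K (-w) = (scaleRatio K w)⁻¹ := by
  rw [scaleRatio, scaleRatio, hK.neg_pow, inv_div]
  congr 1 <;> ring

/-- The polynomial `∑ (1 + ⋯ + w ^ (j - 1)) (1 + ⋯ + w ^ (K - j - 1))`. -/
noncomputable def gapPoly (K : ℕ) (w : ℝ) : ℝ :=
  ∑ j ∈ Finset.range K, (∑ i ∈ Finset.range j, w ^ i) * ∑ i ∈ Finset.range (K - j), w ^ i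

/-- Multiplied by `(1 - w) ^ 2`, the `j`-th summand becomes `(1 - w ^ j) (1 - w ^ (K - j))`. -/
theorem sq_mul_gapPoly (K : ℕ) (w : ℝ) :
    (1 - w) ^ 2 * gapPoly K w
      = K * (1 + w ^ K) - (1 + w) * ∑ j ∈ Finset.range K, w ^ j := by
  have h1 : (1 - w) ^ 2 * gapPoly K w
      = ∑ j ∈ Finset.range K, (1 + w ^ K - w ^ j - w ^ (K - j)) := by
    rw [gapPoly, Finset.mul_sum]
    refine Finset.sum_congr rfl fun j hj => ?_
    have e : w ^ K = w ^ j * w ^ (K - j) := by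
      rw [← pow_add, Nat.add_sub_cancel' (Finset.mem_range.1 hj).le]
    have g1 := geom_sum_mul_neg w j
    have g2 := geom_sum_mul_neg w (K - j)
    calc _ = ((∑ i ∈ Finset.range j, w ^ i) * (1 - w))
          * ((∑ i ∈ Finset.range (K - j), w ^ i) * (1 - w)) := by ring
      _ = _ := by rw [g1, g2, e]; ring
  have h2 : ∑ j ∈ Finset.range K, w ^ (K - j) = w * ∑ j ∈ Finset.range K, w ^ j := by
    rw [← Finset.sum_range_reflect (fun j => w ^ j) K, Finset.mul_sum]
    refine Finset.sum_congr rfl fun j hj => ?_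
    rw [← pow_succ']
    congr 1
    have := Finset.mem_range.1 hj
    omega
  rw [h1, Finset.sum_sub_distrib, Finset.sum_sub_distrib, h2]
  simp
  ring

/-- This exhibits the quadratic contact of `scaleRatio K` with `K` at `w = 1`, the source of the
exponent `1/2`. -/
theorem sub_scaleRatio {K : ℕ} (hK : 0 < K) {w : ℝ} (hw : |w| < 1) :
    K - scaleRatio K w = (1 - w) ^ 2 * gapPoly K w / (1 + w ^ K) := by
  have h1 := abs_lt.1 hw
  have h2 := abs_lt.1 (abs_pow_lt_one hK hw)
  have h3 : 1 - w ≠ 0 := by linarith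
  have h5 : 1 + w ^ K ≠ 0 := by linarith
  rw [sq_mul_gapPoly, scaleRatio, ← geom_sum_mul_neg w K]
  field_simp

theorem gapPoly_nonneg {K : ℕ} {w : ℝ} (hw : |w| < 1) : 0 ≤ gapPoly K w := by
  have h1 := abs_lt.1 hw
  have hg : ∀ j, 0 ≤ ∑ i ∈ Finset.range j, w ^ i := by
    intro j
    have h2 := geom_sum_mul_neg w j
    have h3 : w ^ j ≤ 1 := (le_abs_self _).trans (by
      rw [abs_pow]; exact pow_le_one₀ (abs_nonneg _) hw.le)
    by_contra! h
    nlinarith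
  exact Finset.sum_nonneg fun j _ => mul_nonneg (hg _) (hg _)

theorem scaleRatio_le {K : ℕ} (hK : 0 < K) {w : ℝ} (hw : |w| < 1) : scaleRatio K w ≤ K := by
  have h2 := abs_lt.1 (abs_pow_lt_one hK hw)
  have h := sub_scaleRatio hK hw
  have : 0 ≤ (1 - w) ^ 2 * gapPoly K w / (1 + w ^ K) :=
    div_nonneg (mul_nonneg (sq_nonneg _) (gapPoly_nonneg hw)) (by linarith)
  linarith

theorem scaleRatio_eq_geom_sum (K : ℕ) {w : ℝ} (hw : w ≠ 1) :
    scaleRatio K w = ((1 + w) * ∑ j ∈ Finset.range K, w ^ j) / (1 + w ^ K) := by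
  have h3 : 1 - w ≠ 0 := sub_ne_zero.2 hw.symm
  rw [scaleRatio, ← geom_sum_mul_neg w K,
    show (1 + w) * ((∑ j ∈ Finset.range K, w ^ j) * (1 - w))
      = (1 - w) * ((1 + w) * ∑ j ∈ Finset.range K, w ^ j) by ring, mul_div_mul_left _ _ h3]

/-- Intermediate values of `scaleRatio K`, from a point `a` at which its reduced form is
continuous up to the limit `K` at `1`. -/
theorem exists_scaleRatio_eq_of_le {K : ℕ} {a y : ℝ} (ha : a ≤ 1)
    (hden : ∀ w ∈ Set.Icc a 1, 1 + w ^ K ≠ 0)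
    (hy : ((1 + a) * ∑ j ∈ Finset.range K, a ^ j) / (1 + a ^ K) ≤ y) (hyK : y < K) :
    ∃ w ∈ Set.Ico a 1, scaleRatio K w = y := by
  have hc : ContinuousOn (fun w : ℝ => ((1 + w) * ∑ j ∈ Finset.range K, w ^ j) / (1 + w ^ K))
      (Set.Icc a 1) := ContinuousOn.div (by fun_prop) (by fun_prop) hden
  have h1 : ((1 + (1 : ℝ)) * ∑ j ∈ Finset.range K, (1 : ℝ) ^ j) / (1 + (1 : ℝ) ^ K) = K := by
    simp
  obtain ⟨w, hw, hwy⟩ := intermediate_value_Icc ha hc ⟨hy, by rw [h1]; exact hyK.le⟩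
  have hw1 : w ≠ 1 := by
    rintro rfl
    dsimp only at hwy
    rw [h1] at hwy
    exact hyK.ne hwy.symm
  exact ⟨w, ⟨hw.1, lt_of_le_of_ne hw.2 hw1⟩, by rw [scaleRatio_eq_geom_sum K hw1]; exact hwy⟩

theorem exists_scaleRatio_eq {K : ℕ} (hK : 2 ≤ K) {α : ℝ} (hα : ConditionA K α) :
    ∃ w : ℝ, |w| < 1 ∧ scaleRatio K w = α * K := by
  have hK' : (0 : ℝ) < K := by exact_mod_cast (by omega : 0 < K)
  rcases hα with ⟨he, h0, h1⟩ | ⟨ho, h0, h1⟩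
  -- For even `K` the denominator `1 + w ^ K` never vanishes and the reduced form is `0` at `-1`, so
  -- all values in `(0, K)` are reached; the endpoint itself is then ruled out.
  · have hpos : 0 < α * K := by positivity
    obtain ⟨w, hw, hwy⟩ := exists_scaleRatio_eq_of_le (K := K) (a := -1) (y := α * K) (by norm_num)
      (fun w _ => by have := he.pow_nonneg w; linarith) (by simpa using hpos.le) (by nlinarith)
    refine ⟨w, abs_lt.2 ⟨lt_of_le_of_ne hw.1 ?_, hw.2⟩, hwy⟩
    rintro rfl
    rw [scaleRatio] at hwy
    simp at hwy
    rcases hwy with h | h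
    · exact h0.ne' h
    · omega
  -- For odd `K` the denominator vanishes at `-1`, so start at `0`, where the ratio is `1`. Values
  -- below `1` follow by inversion under `w ↦ -w`, and `α > 1 / K ^ 2` says exactly that `(α K)⁻¹ <
  -- K`.
  · have hex : ∀ y : ℝ, 1 ≤ y → y < K → ∃ w : ℝ, |w| < 1 ∧ scaleRatio K w = y := by
      intro y hy hyK
      obtain ⟨w, hw, hwy⟩ := exists_scaleRatio_eq_of_le (K := K) (a := 0) (y := y) (by norm_num)
        (fun w hw => by have := pow_nonneg hw.1 K; linarith)
        (by
          have : ∑ j ∈ Finset.range K, (0 : ℝ) ^ j = 1 := by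
            rw [Finset.sum_eq_single_of_mem 0 (Finset.mem_range.2 (by omega))
              (fun j _ hj => zero_pow hj), pow_zero]
          rw [this, zero_pow (by omega)]
          simpa using hy) hyK
      exact ⟨w, abs_lt.2 ⟨by linarith [hw.1], hw.2⟩, hwy⟩
    have hα0 : 0 < α := lt_trans (by positivity) h0
    rcases le_or_gt 1 (α * K) with h | h
    · exact hex _ h (by nlinarith)
    · obtain ⟨w, hw, hwy⟩ := hex (α * K)⁻¹ ((one_le_inv₀ (by positivity)).2 h.le) (by
        rw [div_lt_iff₀ (by positivity)] at h0
        rw [inv_lt_iff_one_lt_mul₀ (by positivity)]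
        nlinarith)
      refine ⟨-w, by rwa [abs_neg], ?_⟩
      rw [scaleRatio_neg ho, hwy, inv_inv]

theorem ConditionA.pos {K : ℕ} {α : ℝ} (h : ConditionA K α) : 0 < α := by
  rcases h with h | h
  · exact h.2.1
  · exact lt_of_le_of_lt (by positivity) h.2.1

theorem ConditionA.lt_one {K : ℕ} {α : ℝ} (h : ConditionA K α) : α < 1 := by
  rcases h with h | h
  · exact h.2.2
  · exact h.2.2

theorem existsUnique_isInvariantScale {K : ℕ} (hK : 2 ≤ K) {α : ℝ} (hα : ConditionA K α) :
    ∃! γ : ℝ≥0, IsInvariantScale K α γ := by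
  obtain ⟨w, hw, hwα⟩ := exists_scaleRatio_eq hK hα
  have hK0 : 0 < K := by omega
  have hγ : 0 < (ofDisc w).toNNReal := Real.toNNReal_pos.2 (ofDisc_pos hw)
  have hcoe : ((ofDisc w).toNNReal : ℝ) = ofDisc w := Real.coe_toNNReal _ (ofDisc_pos hw).le
  refine ⟨(ofDisc w).toNNReal, ?_, ?_⟩
  · refine (isInvariantScale_iff hK0 hα.pos hγ).2 ?_
    rw [hcoe, discCoord_ofDisc hw, hwα]
  · intro γ hinv
    have h1 := (isInvariantScale_iff hK0 hα.pos hinv.1).1 hinv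
    have h2 := (strictMonoOn_scaleRatio hK).injOn
      (abs_lt.1 (abs_discCoord_lt_one (γ := γ) hinv.1)) (abs_lt.1 hw) (h1.trans hwα.symm)
    rw [← h2, ofDisc_discCoord (γ := γ) hinv.1, Real.toNNReal_coe]

/-! ### The Lyapunov exponent under Condition A -/

/-- The Lyapunov exponent as a function of the disc coordinate of the invariant law. -/
noncomputable def discExponent (K : ℕ) (w : ℝ) : ℝ :=
  -Real.log ((∑ j ∈ Finset.range K, w ^ (2 * j)) / K)

theorem integral_logAbsDeriv_of_isInvariantScale {K : ℕ} (hK : 0 < K) {α : ℝ} (hα : 0 < α)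
    {γ : ℝ≥0} (h : IsInvariantScale K α γ) :
    Integrable (logAbsDeriv K α) (cauchyMeasure 0 γ) ∧
    ∫ x, logAbsDeriv K α x ∂(cauchyMeasure 0 γ) = discExponent K (discCoord γ) := by
  have hγ := h.1
  have hw := abs_discCoord_lt_one (γ := γ) hγ
  obtain ⟨h1, h2⟩ := integral_logAbsDeriv hK hα hγ (pushScale_pos hK hγ)
    (measurePreserving_cotAngle_pushScale hK hγ)
  refine ⟨h1, h2.trans ?_⟩
  have hr := (isInvariantScale_iff hK hα hγ).1 h
  rw [coe_pushScale hK hγ, ← ofDisc_discCoord (γ := γ) hγ, discCoord_ofDisc hw]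
  set w := discCoord γ
  have a1 := abs_lt.1 hw
  have a2 := abs_lt.1 (abs_pow_lt_one hK hw)
  have hK' : (0 : ℝ) < K := by exact_mod_cast hK
  have b1 : 0 < 1 - w := by linarith
  have b2 : 0 < 1 - w ^ K := by linarith
  have b3 : 0 < 1 + w ^ K := by linarith
  have b4 : 0 < 1 + w := by linarith
  have e1 : 1 + ofDisc w = 2 / (1 - w) := by rw [ofDisc]; field_simp; ring
  have e2 : 1 + ofDisc (w ^ K) = 2 / (1 - w ^ K) := by rw [ofDisc]; field_simp; ring
  have hg := geom_sum_mul_neg (w ^ 2) K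
  simp only [← pow_mul] at hg
  have e3 : (∑ j ∈ Finset.range K, w ^ (2 * j)) = (1 - w ^ K) * (1 + w ^ K)
      / ((1 - w) * (1 + w)) := by
    rw [eq_div_iff (by positivity), show (1 - w) * (1 + w) = 1 - w ^ 2 by ring, hg,
      show 2 * K = K + K by ring, pow_add]
    ring
  -- The invariance equation eliminates `α`; the argument of the logarithm then collapses to `K (1 -
  -- w ^ 2) / (1 - w ^ (2K))`.
  have e4 : α * (K : ℝ) ^ 2 = scaleRatio K w * K := by rw [hr]; ring
  rw [discExponent, e1, e2, e3, e4, scaleRatio, ← Real.log_inv, ← Real.log_rpow (by positivity),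
    ← Real.log_rpow (by positivity), ← Real.log_mul (by positivity) (by positivity),
    ← Real.log_div (by positivity) (by positivity)]
  congr 1
  norm_num
  field_simp

theorem lyapunov_eq_integral {K : ℕ} (hK : 2 ≤ K) {α : ℝ} (hα : ConditionA K α) {γ : ℝ≥0}
    (h : IsInvariantScale K α γ) :
    lyapunov K α = ∫ x, logAbsDeriv K α x ∂(cauchyMeasure 0 γ) := by
  have hex : ∃ γ, IsInvariantScale K α γ := ⟨γ, h⟩
  have : invariantScale K α = γ := by
    rw [invariantScale, dif_pos hex]
    exact (existsUnique_isInvariantScale hK hα).unique hex.choose_spec h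
  rw [lyapunov, if_neg hα.lt_one.not_gt, this]

theorem exists_lyapunov_eq_discExponent {K : ℕ} (hK : 2 ≤ K) {α : ℝ} (hα : ConditionA K α) :
    ∃ w : ℝ, |w| < 1 ∧ scaleRatio K w = α * K ∧ lyapunov K α = discExponent K w := by
  have hK0 : 0 < K := by omega
  obtain ⟨γ, hγ, -⟩ := existsUnique_isInvariantScale hK hα
  refine ⟨discCoord γ, abs_discCoord_lt_one (γ := γ) hγ.1,
    (isInvariantScale_iff hK0 hα.pos hγ.1).1 hγ, ?_⟩
  rw [lyapunov_eq_integral hK hα hγ,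
    (integral_logAbsDeriv_of_isInvariantScale hK0 hα.pos hγ).2]

/-! ### Escape to infinity for `α > 1` -/

theorem mul_le_scale_image {K : ℕ} (hK : 0 < K) {α : ℝ} (hα : 0 < α) {γ : ℝ≥0} (hγ : 0 < γ) :
    α * γ ≤ (α.toNNReal * K * pushScale K γ : ℝ≥0) := by
  have hw := abs_discCoord_lt_one (γ := γ) hγ
  have hv := ofDisc_pos (abs_pow_lt_one hK hw)
  have h := ofDisc_eq_scaleRatio_mul hK hw
  rw [ofDisc_discCoord (γ := γ) hγ] at h
  push_cast
  rw [coe_pushScale hK hγ, Real.coe_toNNReal _ hα.le, mul_assoc]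
  conv_lhs => rw [h]
  exact mul_le_mul_of_nonneg_left (mul_le_mul_of_nonneg_right (scaleRatio_le hK hw) hv.le) hα.le

theorem exists_measurePreserving_iterate {K : ℕ} (hK : 0 < K) {α : ℝ} (hα : 0 < α) (n : ℕ) :
    ∃ γ : ℝ≥0, 0 < γ ∧ α ^ n ≤ γ ∧
      MeasurePreserving (sgb K α)^[n] (cauchyMeasure 0 1) (cauchyMeasure 0 γ) := by
  induction n with
  | zero => exact ⟨1, one_pos, by simp, MeasurePreserving.id _⟩
  | succ n ih =>
    obtain ⟨γ, hγ, hle, hp⟩ := ih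
    have h1 := mul_le_scale_image hK hα hγ
    refine ⟨α.toNNReal * K * pushScale K γ, ?_, ?_, ?_⟩
    · exact mul_pos (mul_pos (Real.toNNReal_pos.2 hα) (by exact_mod_cast hK)) (pushScale_pos hK hγ)
    · rw [pow_succ']
      exact (mul_le_mul_of_nonneg_left hle hα.le).trans h1
    · rw [Function.iterate_succ']
      exact (measurePreserving_sgb hK hα hγ).comp hp

theorem cauchyMeasure_Icc_le {γ : ℝ≥0} (hγ : 0 < γ) (M : ℝ) :
    cauchyMeasure 0 γ (Set.Icc (-M) M) ≤ ENNReal.ofReal (2 * M / (Real.pi * γ)) := by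
  have hg : (0 : ℝ) < γ := hγ
  rw [cauchyMeasure_of_scale_ne_zero _ hγ.ne', withDensity_apply _ measurableSet_Icc]
  have hb : ∀ x, cauchyPDF 0 γ x ≤ ENNReal.ofReal (1 / (Real.pi * γ)) := by
    intro x
    refine ENNReal.ofReal_le_ofReal ?_
    have h1 : ((x - 0) ^ 2 + (γ : ℝ) ^ 2)⁻¹ ≤ ((γ : ℝ) ^ 2)⁻¹ :=
      inv_anti₀ (by positivity) (by nlinarith [sq_nonneg (x - 0)])
    calc cauchyPDFReal 0 γ x ≤ Real.pi⁻¹ * γ * ((γ : ℝ) ^ 2)⁻¹ := by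
          rw [cauchyPDFReal]
          exact mul_le_mul_of_nonneg_left h1 (by positivity)
      _ = 1 / (Real.pi * γ) := by field_simp
  calc ∫⁻ x in Set.Icc (-M) M, cauchyPDF 0 γ x
      ≤ ∫⁻ x in Set.Icc (-M) M, ENNReal.ofReal (1 / (Real.pi * γ)) := lintegral_mono hb
    _ = ENNReal.ofReal (1 / (Real.pi * γ)) * ENNReal.ofReal (M - -M) := by
        rw [setLIntegral_const, Real.volume_Icc]
    _ = _ := by
        rw [← ENNReal.ofReal_mul (by positivity)]
        congr 1
        ring

/-- Started from the Cauchy law of scale `1`, the `n`-th iterate has a Cauchy law of scale at least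
`α ^ n`, so it lies in `[-M, M]` with probability at most `2M / (π α ^ n)`. This is summable, and
Borel–Cantelli applies for each integer `M`. -/
theorem ae_tendsto_abs_iterate {K : ℕ} (hK : 0 < K) {α : ℝ} (hα : 1 < α) :
    ∀ᵐ x : ℝ, Tendsto (fun n : ℕ => |(sgb K α)^[n] x|) atTop atTop := by
  have hα0 : 0 < α := by linarith
  refine (absolutelyContinuous_cauchyMeasure (γ := 1) one_pos).ae_le ?_
  have h : ∀ M : ℕ, ∀ᵐ x ∂(cauchyMeasure 0 1), ∀ᶠ n in atTop,
      x ∉ (sgb K α)^[n] ⁻¹' Set.Icc (-(M : ℝ)) M := by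
    intro M
    refine ae_eventually_notMem ?_
    have hs : Summable fun n : ℕ => 2 * (M : ℝ) / Real.pi * (α⁻¹) ^ n :=
      (summable_geometric_of_lt_one (by positivity) (inv_lt_one_of_one_lt₀ hα)).mul_left _
    refine ne_top_of_le_ne_top hs.tsum_ofReal_ne_top (ENNReal.tsum_le_tsum fun n => ?_)
    obtain ⟨γ, hγ, hle, hp⟩ := exists_measurePreserving_iterate hK hα0 n
    rw [hp.measure_preimage measurableSet_Icc.nullMeasurableSet]
    refine (cauchyMeasure_Icc_le hγ _).trans (ENNReal.ofReal_le_ofReal ?_)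
    have hg : (0 : ℝ) < γ := hγ
    rw [← div_div, div_eq_mul_inv _ (γ : ℝ), inv_pow]
    exact mul_le_mul_of_nonneg_left (inv_anti₀ (by positivity) hle) (by positivity)
  filter_upwards [ae_all_iff.2 h] with x hx
  refine tendsto_atTop.2 fun b => ?_
  obtain ⟨M, hM⟩ := exists_nat_ge b
  filter_upwards [hx M] with n hn
  by_contra! hlt
  exact hn (abs_le.1 (hlt.le.trans hM))

theorem isOrbitExponent_log {K : ℕ} (hK : 0 < K) {α : ℝ} (hα : 1 < α) :
    IsOrbitExponent K α (Real.log α) := by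
  filter_upwards [ae_tendsto_abs_iterate hK hα] with x hx
  have h1 : Tendsto (fun n : ℕ => (sgb K α)^[n] x) atTop (cocompact ℝ) := by
    rw [← Metric.cobounded_eq_cocompact, ← tendsto_norm_atTop_iff_cobounded]
    exact hx
  have h2 : Tendsto (fun n : ℕ => logAbsDeriv K α ((sgb K α)^[n] x)) atTop (𝓝 (Real.log |α|)) :=
    (((tendsto_deriv_sgb hK α).comp h1).abs).log (by positivity)
  rw [Real.log_abs] at h2
  exact h2.cesaro

theorem IsOrbitExponent.unique {K : ℕ} {α L L' : ℝ} (h : IsOrbitExponent K α L)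
    (h' : IsOrbitExponent K α L') : L = L' := by
  obtain ⟨x, hx, hx'⟩ := (h.and h').exists
  exact tendsto_nhds_unique hx hx'

theorem lyapunov_of_one_lt {K : ℕ} (hK : 0 < K) {α : ℝ} (hα : 1 < α) :
    lyapunov K α = Real.log α := by
  rw [lyapunov, if_pos hα]
  exact (Classical.epsilon_spec ⟨_, isOrbitExponent_log hK hα⟩).unique (isOrbitExponent_log hK hα)

/-! ### Critical exponents -/

theorem hasCriticalExponent_of_tendsto {lam : ℝ → ℝ} {l : Filter ℝ} {αc ν b : ℝ} (hb : 0 < b)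
    (h : Tendsto (fun α => lam α / |α - αc| ^ ν) l (𝓝 b)) : HasCriticalExponent lam l αc ν := by
  refine ⟨b, hb, Asymptotics.isEquivalent_of_tendsto_one ?_⟩
  have h1 := h.div_const b
  rw [div_self hb.ne'] at h1
  refine h1.congr fun α => ?_
  rw [Pi.div_apply, div_div, mul_comm]

theorem scaleRatio_lt {K : ℕ} (hK : 2 ≤ K) {w : ℝ} (hw : |w| < 1) : scaleRatio K w < K := by
  have h := abs_lt.1 hw
  exact (strictMonoOn_scaleRatio hK h (b := (w + 1) / 2) ⟨by linarith, by linarith⟩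
    (by linarith)).trans_le
      (scaleRatio_le (by omega) (abs_lt.2 ⟨by linarith, by linarith⟩))

/-- By monotonicity the value `K` can be approached only at the right end of `(-1, 1)`. -/
theorem tendsto_nhdsLT_one_of_scaleRatio {ι : Type*} {l : Filter ι} {K : ℕ} (hK : 2 ≤ K)
    {u : ι → ℝ} (hu : ∀ᶠ i in l, |u i| < 1)
    (h : Tendsto (fun i => scaleRatio K (u i)) l (𝓝 K)) : Tendsto u l (𝓝[<] 1) := by
  refine tendsto_nhdsWithin_iff.2 ⟨tendsto_order.2 ⟨fun a ha => ?_, fun a ha => ?_⟩, ?_⟩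
  -- The maximum with `0` moves the lower bound into `(-1, 1)`, where monotonicity is available.
  · have hm : |max a 0| < 1 := by
      rw [abs_of_nonneg (le_max_right _ _)]
      exact max_lt ha one_pos
    filter_upwards [hu, h.eventually_const_lt (scaleRatio_lt hK hm)] with i hi hlt
    exact (le_max_left a 0).trans_lt
      (((strictMonoOn_scaleRatio hK).lt_iff_lt (abs_lt.1 hm) (abs_lt.1 hi)).1 hlt)
  · filter_upwards [hu] with i hi
    exact (abs_lt.1 hi).2.trans ha
  · filter_upwards [hu] with i hi using (abs_lt.1 hi).2

/-- `discExponent K` vanishes at `1` and is differentiable there, with negative derivative `-(∑ 2j)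
/ K`. -/
theorem exists_tendsto_discExponent_div {K : ℕ} (hK : 2 ≤ K) :
    ∃ d : ℝ, 0 < d ∧ Tendsto (fun w => discExponent K w / (1 - w)) (𝓝[<] 1) (𝓝 d) := by
  have hK' : (0 : ℝ) < K := by exact_mod_cast (by omega : 0 < K)
  have hs : HasDerivAt (fun w : ℝ => (∑ j ∈ Finset.range K, w ^ (2 * j)) / K)
      ((∑ j ∈ Finset.range K, (2 * j : ℝ)) / K) 1 := by
    refine (HasDerivAt.fun_sum fun j _ => ?_).div_const _
    simpa using hasDerivAt_pow (2 * j) (1 : ℝ)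
  have h1 : (∑ j ∈ Finset.range K, (1 : ℝ) ^ (2 * j)) / K = 1 := by
    simp [hK'.ne']
  have hd : HasDerivAt (discExponent K) (-((∑ j ∈ Finset.range K, (2 * j : ℝ)) / K)) 1 := by
    have := (hs.log (by rw [h1]; exact one_ne_zero)).neg
    rw [h1, div_one] at this
    exact this
  have h0 : discExponent K 1 = 0 := by rw [discExponent, h1, Real.log_one, neg_zero]
  refine ⟨(∑ j ∈ Finset.range K, (2 * j : ℝ)) / K, div_pos ?_ hK', ?_⟩
  · exact Finset.sum_pos' (fun j _ => by positivity) ⟨1, Finset.mem_range.2 (by omega), by norm_num⟩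
  · have ht := (hasDerivAt_iff_tendsto_slope.1 hd).neg.mono_left (nhdsLT_le_nhdsNE 1)
    rw [neg_neg] at ht
    refine ht.congr fun w => ?_
    rw [slope_def_field, h0, sub_zero, ← div_neg, neg_sub]

theorem gapPoly_one_pos {K : ℕ} (hK : 2 ≤ K) : 0 < gapPoly K 1 := by
  refine Finset.sum_pos' (fun j _ => by positivity) ⟨1, Finset.mem_range.2 (by omega), ?_⟩
  have : 0 < K - 1 := by omega
  simpa using this

theorem tendsto_sub_scaleRatio_div {K : ℕ} (hK : 2 ≤ K) :
    Tendsto (fun w => (K - scaleRatio K w) / (1 - w) ^ 2) (𝓝[<] 1) (𝓝 (gapPoly K 1 / 2)) := by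
  have hc : ContinuousAt (fun w : ℝ => gapPoly K w / (1 + w ^ K)) 1 := by
    unfold gapPoly
    exact ContinuousAt.div (by fun_prop) (by fun_prop) (by norm_num)
  have ht := hc.tendsto.mono_left (nhdsWithin_le_nhds (s := Set.Iio 1))
  simp only [one_pow, one_add_one_eq_two] at ht
  refine ht.congr' ?_
  filter_upwards [Ioo_mem_nhdsLT (show (-1 : ℝ) < 1 by norm_num)] with w hw
  have h3 : 1 - w ≠ 0 := by linarith [hw.2]
  rw [sub_scaleRatio (by omega) (abs_lt.2 hw), mul_div_assoc,
    mul_div_cancel_left₀ _ (pow_ne_zero 2 h3)]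

theorem exists_tendsto_discExponent_div_sqrt {K : ℕ} (hK : 2 ≤ K) :
    ∃ b : ℝ, 0 < b ∧
      Tendsto (fun w => discExponent K w / √(K - scaleRatio K w)) (𝓝[<] 1) (𝓝 b) := by
  obtain ⟨d, hd, hdt⟩ := exists_tendsto_discExponent_div hK
  have hc : 0 < √(gapPoly K 1 / 2) := Real.sqrt_pos.2 (half_pos (gapPoly_one_pos hK))
  refine ⟨d / √(gapPoly K 1 / 2), div_pos hd hc, ?_⟩
  refine (hdt.div (tendsto_sub_scaleRatio_div hK).sqrt hc.ne').congr' ?_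
  filter_upwards [self_mem_nhdsWithin] with w hw
  have h3 : 0 < 1 - w := sub_pos.2 hw
  rw [Pi.div_apply, Real.sqrt_div' _ (by positivity), Real.sqrt_sq h3.le,
    div_div_div_cancel_right₀ h3.ne']

theorem discExponent_neg (K : ℕ) (w : ℝ) : discExponent K (-w) = discExponent K w := by
  simp only [discExponent, (even_two_mul _).neg_pow]

theorem hasCriticalExponent_nhdsLT_one {K : ℕ} (hK : 2 ≤ K) :
    HasCriticalExponent (lyapunov K) (𝓝[<] 1) 1 (1 / 2) := by
  have hK' : (2 : ℝ) ≤ K := by exact_mod_cast hK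
  obtain ⟨b, hb, hbt⟩ := exists_tendsto_discExponent_div_sqrt hK
  choose! W hW1 hW2 hW3 using fun α => exists_lyapunov_eq_discExponent (K := K) (α := α) hK
  have hA : ∀ᶠ α : ℝ in 𝓝[<] 1, ConditionA K α := by
    have hlt : 1 / (K : ℝ) ^ 2 < 1 := by rw [div_lt_one (by positivity)]; nlinarith
    filter_upwards [Ioo_mem_nhdsLT hlt] with α hα
    rcases Nat.even_or_odd K with h | h
    · exact Or.inl ⟨h, lt_trans (by positivity) hα.1, hα.2⟩
    · exact Or.inr ⟨h, hα⟩
  have hid : Tendsto (fun α : ℝ => α * K) (𝓝[<] 1) (𝓝 K) := by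
    have : Tendsto (fun α : ℝ => α * K) (𝓝 1) (𝓝 (1 * K)) := tendsto_id.mul_const _
    rw [one_mul] at this
    exact this.mono_left nhdsWithin_le_nhds
  have hWt : Tendsto W (𝓝[<] 1) (𝓝[<] 1) :=
    tendsto_nhdsLT_one_of_scaleRatio hK (hA.mono hW1)
      (hid.congr' (hA.mono fun α h => (hW2 α h).symm))
  refine hasCriticalExponent_of_tendsto (b := b * √K)
    (mul_pos hb (Real.sqrt_pos.2 (by linarith))) ?_
  refine ((hbt.comp hWt).mul_const _).congr' ?_
  filter_upwards [hA] with α hα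
  -- Dividing by `K` here accounts for the factor `√K` in the constant.
  have h1 : |α - 1| = (K - scaleRatio K (W α)) / K := by
    rw [hW2 α hα, abs_sub_comm, abs_of_pos (sub_pos.2 hα.lt_one)]
    field_simp
  rw [Function.comp_apply, hW3 α hα, h1, ← Real.sqrt_eq_rpow, Real.sqrt_div' _ (by positivity),
    div_div_eq_mul_div, div_mul_eq_mul_div]

theorem hasCriticalExponent_nhdsGT_inv_sq {K : ℕ} (hK : 2 ≤ K) (ho : Odd K) :
    HasCriticalExponent (lyapunov K) (𝓝[>] (1 / (K : ℝ) ^ 2)) (1 / (K : ℝ) ^ 2) (1 / 2) := by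
  have hK' : (2 : ℝ) ≤ K := by exact_mod_cast hK
  have hK0 : (0 : ℝ) < K := by linarith
  obtain ⟨b, hb, hbt⟩ := exists_tendsto_discExponent_div_sqrt hK
  choose! W hW1 hW2 hW3 using fun α => exists_lyapunov_eq_discExponent (K := K) (α := α) hK
  have hA : ∀ᶠ α : ℝ in 𝓝[>] (1 / (K : ℝ) ^ 2), ConditionA K α := by
    have hlt : 1 / (K : ℝ) ^ 2 < 1 := by rw [div_lt_one (by positivity)]; nlinarith
    filter_upwards [Ioo_mem_nhdsGT hlt] with α hα using Or.inr ⟨ho, hα⟩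
  have hne : 1 / (K : ℝ) ^ 2 * K ≠ 0 := by positivity
  have hid : Tendsto (fun α : ℝ => (α * K)⁻¹) (𝓝[>] (1 / (K : ℝ) ^ 2)) (𝓝 K) := by
    have : Tendsto (fun α : ℝ => (α * K)⁻¹) (𝓝 (1 / (K : ℝ) ^ 2)) (𝓝 (1 / (K : ℝ) ^ 2 * K)⁻¹) :=
      (tendsto_id.mul_const _).inv₀ hne
    have e : (1 / (K : ℝ) ^ 2 * K)⁻¹ = (K : ℝ) := by field_simp
    rw [e] at this
    exact this.mono_left nhdsWithin_le_nhds
  have hH : ∀ α, ConditionA K α → scaleRatio K (-W α) = (α * K)⁻¹ := fun α h => by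
    rw [scaleRatio_neg ho, hW2 α h]
  have hWt : Tendsto (fun α => -W α) (𝓝[>] (1 / (K : ℝ) ^ 2)) (𝓝[<] 1) :=
    tendsto_nhdsLT_one_of_scaleRatio hK (hA.mono fun α h => by rw [abs_neg]; exact hW1 α h)
      (hid.congr' (hA.mono fun α h => (hH α h).symm))
  -- The distance to `1 / K ^ 2` is `(K - (α K)⁻¹) / (K / α)`; its factor `K / α` varies with `α`
  -- and so contributes its limit to the constant.
  have hr : Tendsto (fun α : ℝ => √(K / α)) (𝓝[>] (1 / (K : ℝ) ^ 2))
      (𝓝 √(K / (1 / (K : ℝ) ^ 2))) := by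
    have : Tendsto (fun α : ℝ => √(K / α)) (𝓝 (1 / (K : ℝ) ^ 2)) (𝓝 √(K / (1 / (K : ℝ) ^ 2))) :=
      (tendsto_const_nhds.div tendsto_id (by positivity)).sqrt
    exact this.mono_left nhdsWithin_le_nhds
  refine hasCriticalExponent_of_tendsto (b := b * √(K / (1 / (K : ℝ) ^ 2)))
    (mul_pos hb (Real.sqrt_pos.2 (by positivity))) ?_
  refine ((hbt.comp hWt).mul hr).congr' ?_
  filter_upwards [hA, self_mem_nhdsWithin] with α hα hgt
  have hα0 := hα.pos
  have h1 : |α - 1 / (K : ℝ) ^ 2| = (K - scaleRatio K (-W α)) / (K / α) := by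
    rw [hH α hα, abs_of_pos (sub_pos.2 hgt)]
    field_simp
  rw [Function.comp_apply, discExponent_neg, hW3 α hα, h1, ← Real.sqrt_eq_rpow,
    Real.sqrt_div' (K - scaleRatio K (-W α)) (by positivity), div_div_eq_mul_div,
    div_mul_eq_mul_div]

theorem hasCriticalExponent_nhdsGT_one {K : ℕ} (hK : 0 < K) :
    HasCriticalExponent (lyapunov K) (𝓝[>] 1) 1 1 := by
  refine hasCriticalExponent_of_tendsto one_pos ?_
  have h := (hasDerivAt_iff_tendsto_slope.1 (Real.hasDerivAt_log one_ne_zero)).mono_left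
    (nhdsGT_le_nhdsNE 1)
  rw [inv_one] at h
  refine h.congr' ?_
  filter_upwards [self_mem_nhdsWithin] with α hα
  rw [slope_def_field, Real.log_one, sub_zero, lyapunov_of_one_lt hK hα, Real.rpow_one,
    abs_of_pos (sub_pos.2 hα)]

end SGB

theorem theoremC (K : ℕ) (hK : 2 ≤ K) :
    -- under Condition A: the invariant Cauchy law, and the Lyapunov exponent as an integral
    (∀ α : ℝ, SGB.ConditionA K α →
      (∃! γ : ℝ≥0, SGB.IsInvariantScale K α γ) ∧
      ∀ γ : ℝ≥0, SGB.IsInvariantScale K α γ →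
        Integrable (SGB.logAbsDeriv K α) (cauchyMeasure 0 γ) ∧
        SGB.lyapunov K α = ∫ x, SGB.logAbsDeriv K α x ∂(cauchyMeasure 0 γ)) ∧
    -- for `α > 1`: almost every orbit tends to infinity, with Lyapunov exponent `log α`
    (∀ α : ℝ, 1 < α →
      (∀ᵐ x : ℝ, Tendsto (fun n : ℕ => |(SGB.sgb K α)^[n] x|) atTop atTop) ∧
      SGB.IsOrbitExponent K α (SGB.lyapunov K α) ∧
      SGB.lyapunov K α = Real.log α) ∧
    -- the critical exponents
    SGB.HasCriticalExponent (SGB.lyapunov K) (𝓝[<] 1) 1 (1 / 2) ∧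
    SGB.HasCriticalExponent (SGB.lyapunov K) (𝓝[>] 1) 1 1 ∧
    (Odd K → SGB.HasCriticalExponent (SGB.lyapunov K)
      (𝓝[>] (1 / (K : ℝ) ^ 2)) (1 / (K : ℝ) ^ 2) (1 / 2)) ∧
    -- the two critical points are points of Type 1 intermittency
    SGB.IsTangentAtInfinity (SGB.sgb K 1) ∧
    (Odd K → SGB.IsTangentAt (SGB.sgb K (1 / (K : ℝ) ^ 2)) 0) := by
  have hK0 : 0 < K := by omega
  refine ⟨fun α hα => ⟨SGB.existsUnique_isInvariantScale hK hα, fun γ hγ =>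
      ⟨(SGB.integral_logAbsDeriv_of_isInvariantScale hK0 hα.pos hγ).1,
        SGB.lyapunov_eq_integral hK hα hγ⟩⟩,
    fun α hα => ⟨SGB.ae_tendsto_abs_iterate hK0 hα, ?_, SGB.lyapunov_of_one_lt hK0 hα⟩,
    SGB.hasCriticalExponent_nhdsLT_one hK, SGB.hasCriticalExponent_nhdsGT_one hK0,
    SGB.hasCriticalExponent_nhdsGT_inv_sq hK,
    ⟨SGB.tendsto_sgb_cocompact hK0 one_pos, SGB.tendsto_deriv_sgb hK0 1⟩,
    SGB.isTangentAt_zero⟩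
  rw [SGB.lyapunov_of_one_lt hK0 hα]
  exact SGB.isOrbitExponent_log hK0 hα
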